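/- Let $n\ge 0$ be an integer, let $p,q,c$ be real numbers with $c\ge 0$, and put $V(x)=c\,|x|_q^{\,p}$ for $x\in\mathbb R^n$, where $|x|_q=\bigl(\sum_{i=1}^n|x_i|^q\bigr)^{1/q}$. For a function $\Phi:\mathbb R^n\to(-\infty,+\infty]$ that is not identically $+\infty$ (a proper function; convexity is not required) let $\Phi^*(y)=\sup_{x\in\mathbb R^n}\bigl(\langle x,y\rangle-\Phi(x)\bigr)$ be its Legendre transform. Consider the generalized Blaschke--Santaló inequality $$\int_{\mathbb R^n} e^{-\Phi(x)}\,dx\;\Bigl(\int_{\mathbb R^n} e^{-\frac1{p-1}\Phi^*(\nabla V(y))}\,dy\Bigr)^{p-1}\le\Bigl(\int_{\mathbb R^n} e^{-V(x)}\,dx\Bigr)^{p},$$ in which the integrals take values in $[0,\infty]$, with $e^{-\infty}=0$ and $0\cdot\infty=0$. 1. If $p\ge q>1$, the inequality holds for every proper unconditional $\Phi$, that is, every proper $\Phi$ with $\Phi(\pm x_1,\dots,\pm x_n)=\Phi(x_1,\dots,x_n)$ for all $x$ and all choices of signs. 2. If $p\ge q\ge 2$, the inequality holds for every proper even $\Phi$,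 that is, every proper $\Phi$ with $\Phi(-x)=\Phi(x)$ for all $x$. -/

import Mathlib

open MeasureTheory
open scoped ENNReal

noncomputable section

namespace BlaschkeSantalo

/-- A function with values in `(-∞, +∞]` that is not identically `+∞`. -/
def IsProper {n : ℕ} (Φ : EuclideanSpace ℝ (Fin n) → EReal) : Prop :=
  (∀ x, Φ x ≠ ⊥) ∧ ∃ x, Φ x ≠ ⊤

/-- `Φ (±x₁, …, ±xₙ) = Φ (x₁, …, xₙ)` for every choice of signs. -/
def IsUnconditional {n : ℕ} (Φ : EuclideanSpace ℝ (Fin n) → EReal) : Prop :=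
  ∀ ε : Fin n → ℝ, (∀ i, ε i = 1 ∨ ε i = -1) →
    ∀ x : EuclideanSpace ℝ (Fin n), Φ (WithLp.toLp 2 fun i => ε i * x i) = Φ x

/-- The Legendre transform `Φ^*(y) = sup_x (⟨x, y⟩ - Φ(x))`. -/
def legendre {n : ℕ} (Φ : EuclideanSpace ℝ (Fin n) → EReal)
    (y : EuclideanSpace ℝ (Fin n)) : EReal :=
  ⨆ x : EuclideanSpace ℝ (Fin n), ((inner ℝ x y : ℝ) : EReal) - Φ x

/-- The `l^q`-norm `|x|_q = (∑ |x_i|^q)^{1/q}`. -/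
def lqNorm {n : ℕ} (q : ℝ) (x : EuclideanSpace ℝ (Fin n)) : ℝ :=
  (∑ i, |x i| ^ q) ^ (1 / q)

/-- The inequality `∫ e^{-Φ} dx · (∫ e^{-Φ^*(∇V(y))/(p-1)} dy)^{p-1} ≤ (∫ e^{-V} dx)^p`.
The integrals are `[0, ∞]`-valued, with `e^{-∞} = 0` and `0 · ∞ = 0`. -/
def GeneralizedBS {n : ℕ} (p : ℝ) (V : EuclideanSpace ℝ (Fin n) → ℝ)
    (Φ : EuclideanSpace ℝ (Fin n) → EReal) : Prop :=
  (∫⁻ x, EReal.exp (-Φ x)) *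
      (∫⁻ y, EReal.exp (-(((1 / (p - 1) : ℝ) : EReal) * legendre Φ (gradient V y)))) ^ (p - 1)
    ≤ (∫⁻ x, ENNReal.ofReal (Real.exp (-V x))) ^ p

end BlaschkeSantalo

end

/-!
Put `F = e^{-Φ}` and `G = e^{-Φ^*}`, so that `F x * G u ≤ e^{-⟨x, u⟩}`, and `T = ∇V`. Only this
pointwise bound matters: the claim is an upper bound for `∫ F * (∫ (G ∘ T)^(1/(p-1)))^(p-1)`.

If `F` and `G` are unconditional, the integrals live on the positive orthant, where the substitution
`x = e^t` turns the Prékopa–Leindler inequality into one for the geometric means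
`z i = (x i)^(1/p) * (y i)^((p-1)/p)`. Its hypothesis, with `e^{-V}` on the right, reads
`V z ≤ ⟨x, T y⟩ / p`, and for `V = c |x|_q^p` with `q ≤ p` this is Hölder's inequality.

If `F` and `G` are only even, replace `F` by its symmetrization in one coordinate and `G` by its
symmetrization in the complementary coordinates. This keeps the pair polar, since the two
displacements are orthogonal, and after all coordinates have been treated the pair is unconditional.
By Prékopa–Leindler neither integral decreases, provided that the image of Lebesgue measure under
`T`, with respect to which `G^(1/(p-1))` is integrated, has a density that is a product of
quasiconcave functions invariant under reflections. Its factors are `|s i|^(1/(q-1) - 1)` and a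
nonpositive power of a convex function of `s`, and the former are quasiconcave exactly when `q ≥ 2`.

Suprema over small balls make `F` and `G` lower semicontinuous, hence measurable, at the cost of a
constant factor that tends to `1`.
-/

noncomputable section

namespace BlaschkeSantalo

open Set Filter Topology
open scoped Pointwise symmDiff

section PrekopaLeindler

theorem volume_add_volume_le_of_isCompact {K L : Set ℝ} (hK : IsCompact K) (hL : IsCompact L)
    (hK₀ : K.Nonempty) (hL₀ : L.Nonempty) : volume K + volume L ≤ volume (K + L) := by
  obtain ⟨a, haK, ha⟩ := hK.exists_isGreatest hK₀
  obtain ⟨b, hbL, hb⟩ := hL.exists_isLeast hL₀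
  -- Two translates of `K` and `L` inside `K + L` meet only at `a + b`.
  have hdisj : AEDisjoint volume ((· + b) '' K) ((a + ·) '' L) := by
    refine measure_mono_null (t := {a + b}) ?_ (by simp)
    rintro _ ⟨⟨x, hx, rfl⟩, ⟨y, hy, hxy : a + y = x + b⟩⟩
    have hxa : x ≤ a := ha hx
    have hby : b ≤ y := hb hy
    exact mem_singleton_iff.2 (by linarith)
  calc volume K + volume L = volume ((· + b) '' K) + volume ((a + ·) '' L) := by
        rw [image_add_right, measure_preimage_add_right, image_add_left, measure_preimage_add]
    _ = volume ((· + b) '' K ∪ (a + ·) '' L) :=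
        (measure_union₀ (hL.image (by fun_prop)).nullMeasurableSet hdisj).symm
    _ ≤ volume (K + L) := measure_mono <| union_subset
        (image_subset_iff.2 fun _ hx => add_mem_add hx hbL)
        (image_subset_iff.2 fun _ hy => add_mem_add haK hy)

theorem volume_add_volume_le {A B : Set ℝ} (hA : MeasurableSet A) (hB : MeasurableSet B)
    (hA₀ : A.Nonempty) (hB₀ : B.Nonempty) : volume A + volume B ≤ volume (A + B) := by
  obtain ⟨a, ha⟩ := hA₀
  obtain ⟨b, hb⟩ := hB₀
  rw [hA.measure_eq_iSup_isCompact, hB.measure_eq_iSup_isCompact]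
  simp_rw [iSup_and']
  refine ENNReal.biSup_add_biSup_le' ⟨{a}, by simp [ha]⟩ ⟨{b}, by simp [hb]⟩ ?_
  rintro K ⟨hKA, hK⟩ L ⟨hLB, hL⟩
  calc volume K + volume L ≤ volume (insert a K) + volume (insert b L) :=
        add_le_add (measure_mono (subset_insert a K)) (measure_mono (subset_insert b L))
    _ ≤ volume (insert a K + insert b L) := volume_add_volume_le_of_isCompact (hK.insert a)
        (hL.insert b) (insert_nonempty _ _) (insert_nonempty _ _)
    _ ≤ volume (A + B) :=
        measure_mono (add_subset_add (insert_subset ha hKA) (insert_subset hb hLB))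

theorem volume_smul_add_volume_smul_le {s t : ℝ} (hs : 0 < s) (ht : 0 < t) {A B : Set ℝ}
    (hA : MeasurableSet A) (hB : MeasurableSet B) (hA₀ : A.Nonempty) (hB₀ : B.Nonempty) :
    ENNReal.ofReal s * volume A + ENNReal.ofReal t * volume B ≤ volume (s • A + t • B) := by
  have volume_smul {r : ℝ} (hr : 0 < r) (S : Set ℝ) :
      volume (r • S) = ENNReal.ofReal r * volume S := by
    simp [Measure.addHaar_smul, abs_of_pos hr]
  rw [← volume_smul hs, ← volume_smul ht]
  exact volume_add_volume_le (hA.const_smul₀ s) (hB.const_smul₀ t) hA₀.smul_set hB₀.smul_set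

theorem volume_ofReal_lt (a : ℝ≥0∞) :
    volume.restrict (Ioi (0 : ℝ)) {t | ENNReal.ofReal t < a} = a := by
  rw [Measure.restrict_apply (measurableSet_lt (by fun_prop) (by fun_prop))]
  rcases eq_or_ne a ∞ with rfl | ha
  · simp
  · have : {t | ENNReal.ofReal t < a} ∩ Ioi 0 = Ioo 0 a.toReal := by
      ext t
      simp only [mem_inter_iff, mem_ofPred_eq, mem_Ioi, mem_Ioo, and_comm (b := 0 < t)]
      exact and_congr_right fun ht => ENNReal.ofReal_lt_iff_lt_toReal ht.le ha
    rw [this, Real.volume_Ioo, sub_zero, ENNReal.ofReal_toReal ha]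

/- Mathlib's layer cake formulas are stated for real-valued functions only. -/
theorem lintegral_eq_lintegral_measure_ofReal_lt {X : Type*} [MeasurableSpace X] {μ : Measure X}
    [SFinite μ] {w : X → ℝ≥0∞} (hw : Measurable w) :
    ∫⁻ x, w x ∂μ = ∫⁻ t in Ioi (0 : ℝ), μ {x | ENNReal.ofReal t < w x} := by
  have hmeas : MeasurableSet {z : X × ℝ | ENNReal.ofReal z.2 < w z.1} :=
    measurableSet_lt (by fun_prop) (by fun_prop)
  calc ∫⁻ x, w x ∂μ = ∫⁻ x, volume.restrict (Ioi 0) {t | ENNReal.ofReal t < w x} ∂μ := by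
        simp_rw [volume_ofReal_lt]
    _ = μ.prod (volume.restrict (Ioi 0)) {z | ENNReal.ofReal z.2 < w z.1} :=
        (Measure.prod_apply hmeas).symm
    _ = ∫⁻ t in Ioi (0 : ℝ), μ {x | ENNReal.ofReal t < w x} := Measure.prod_apply_symm hmeas

theorem ennreal_geom_mean_le_arith_mean {s t : ℝ} (hs : 0 < s) (ht : 0 < t) (hst : s + t = 1)
    (a b : ℝ≥0∞) : a ^ s * b ^ t ≤ ENNReal.ofReal s * a + ENNReal.ofReal t * b := by
  have young := ENNReal.young_inequality (a ^ s) (b ^ t)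
    (Real.HolderConjugate.inv_inv hs ht hst)
  simpa only [← ENNReal.rpow_mul, mul_inv_cancel₀ hs.ne', mul_inv_cancel₀ ht.ne',
    ENNReal.rpow_one, ENNReal.ofReal_inv_of_pos hs, ENNReal.ofReal_inv_of_pos ht, div_eq_mul_inv,
    inv_inv, mul_comm] using young

variable {s t : ℝ} {f g h : ℝ → ℝ≥0∞}

theorem superlevel_smul_add_smul_subset (hs : 0 < s) (ht : 0 < t) (hst : s + t = 1)
    (H : ∀ x y, f x ^ s * g y ^ t ≤ h (s * x + t * y)) (a : ℝ≥0∞) :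
    s • {x | a < f x} + t • {x | a < g x} ⊆ {x | a < h x} := by
  rintro _ ⟨_, ⟨x, hx, rfl⟩, _, ⟨y, hy, rfl⟩, rfl⟩
  calc a = a ^ s * a ^ t := by
        rw [← ENNReal.rpow_add_of_nonneg _ _ hs.le ht.le, hst, ENNReal.rpow_one]
    _ < f x ^ s * g y ^ t :=
        ENNReal.mul_lt_mul (ENNReal.rpow_lt_rpow hx hs) (ENNReal.rpow_lt_rpow hy ht)
    _ ≤ h (s * x + t * y) := H x y

theorem volume_superlevel_le (hs : 0 < s) (ht : 0 < t) (hst : s + t = 1) (hf : Measurable f)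
    (hg : Measurable g) (hf₁ : ⨆ x, f x = 1) (hg₁ : ⨆ x, g x = 1)
    (H : ∀ x y, f x ^ s * g y ^ t ≤ h (s * x + t * y)) (a : ℝ≥0∞) :
    ENNReal.ofReal s * volume {x | a < f x} + ENNReal.ofReal t * volume {x | a < g x}
      ≤ volume {x | a < h x} := by
  rcases lt_or_ge a 1 with ha | ha
  · exact (volume_smul_add_volume_smul_le hs ht (measurableSet_lt measurable_const hf)
      (measurableSet_lt measurable_const hg) (lt_iSup_iff.1 (ha.trans_eq hf₁.symm))
      (lt_iSup_iff.1 (ha.trans_eq hg₁.symm))).trans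
      (measure_mono (superlevel_smul_add_smul_subset hs ht hst H a))
  · have hf₀ : {x | a < f x} = ∅ :=
      eq_empty_of_forall_notMem fun x => ((hf₁ ▸ le_iSup f x).trans ha).not_gt
    have hg₀ : {x | a < g x} = ∅ :=
      eq_empty_of_forall_notMem fun x => ((hg₁ ▸ le_iSup g x).trans ha).not_gt
    simp [hf₀, hg₀]

theorem lintegral_add_lintegral_le_of_iSup_eq_one (hs : 0 < s) (ht : 0 < t) (hst : s + t = 1)
    (hf : Measurable f) (hg : Measurable g) (hh : Measurable h) (hf₁ : ⨆ x, f x = 1)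
    (hg₁ : ⨆ x, g x = 1) (H : ∀ x y, f x ^ s * g y ^ t ≤ h (s * x + t * y)) :
    ENNReal.ofReal s * (∫⁻ x, f x) + ENNReal.ofReal t * (∫⁻ x, g x) ≤ ∫⁻ x, h x := by
  have hanti : Antitone fun r : ℝ => volume {x | ENNReal.ofReal r < f x} := fun a b hab =>
    measure_mono fun x hx => (ENNReal.ofReal_le_ofReal hab).trans_lt hx
  rw [lintegral_eq_lintegral_measure_ofReal_lt hf, lintegral_eq_lintegral_measure_ofReal_lt hg,
    lintegral_eq_lintegral_measure_ofReal_lt hh, ← lintegral_const_mul' _ _ (by simp),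
    ← lintegral_const_mul' _ _ (by simp),
    ← lintegral_add_left' (hanti.measurable.const_mul _).aemeasurable]
  exact lintegral_mono fun r => volume_superlevel_le hs ht hst hf hg hf₁ hg₁ H _

theorem lintegral_rpow_mul_lintegral_rpow_le_of_iSup_ne_top (hs : 0 < s) (ht : 0 < t)
    (hst : s + t = 1) (hf : Measurable f) (hg : Measurable g) (hh : Measurable h)
    (hf_top : ⨆ x, f x ≠ ∞) (hg_top : ⨆ x, g x ≠ ∞)
    (H : ∀ x y, f x ^ s * g y ^ t ≤ h (s * x + t * y)) :
    (∫⁻ x, f x) ^ s * (∫⁻ x, g x) ^ t ≤ ∫⁻ x, h x := by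
  set a := ⨆ x, f x with ha
  set b := ⨆ x, g x with hb
  rcases eq_or_ne a 0 with ha₀ | ha₀
  · simp [ENNReal.iSup_eq_zero.1 (ha ▸ ha₀), hs]
  rcases eq_or_ne b 0 with hb₀ | hb₀
  · simp [ENNReal.iSup_eq_zero.1 (hb ▸ hb₀), ht]
  have has_top : a ^ s ≠ ∞ := ENNReal.rpow_ne_top_of_nonneg hs.le hf_top
  have hbt_top : b ^ t ≠ ∞ := ENNReal.rpow_ne_top_of_nonneg ht.le hg_top
  have hab₀ : a ^ s * b ^ t ≠ 0 := by
    simp [ha₀, hb₀, hf_top, hg_top, ENNReal.rpow_eq_zero_iff]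
  have hinv : (a ^ s * b ^ t)⁻¹ = a⁻¹ ^ s * b⁻¹ ^ t := by
    rw [ENNReal.mul_inv (Or.inr hbt_top) (Or.inl has_top), ENNReal.inv_rpow, ENNReal.inv_rpow]
  have pull (u v : ℝ≥0∞) :
      (a⁻¹ * u) ^ s * (b⁻¹ * v) ^ t = (a ^ s * b ^ t)⁻¹ * (u ^ s * v ^ t) := by
    rw [ENNReal.mul_rpow_of_nonneg _ _ hs.le, ENNReal.mul_rpow_of_nonneg _ _ ht.le,
      mul_mul_mul_comm, hinv]
  have normalised := (ennreal_geom_mean_le_arith_mean hs ht hst _ _).trans <|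
    lintegral_add_lintegral_le_of_iSup_eq_one hs ht hst (hf.const_mul a⁻¹) (hg.const_mul b⁻¹)
      (hh.const_mul (a ^ s * b ^ t)⁻¹)
      (by rw [← ENNReal.mul_iSup, ← ha, ENNReal.inv_mul_cancel ha₀ hf_top])
      (by rw [← ENNReal.mul_iSup, ← hb, ENNReal.inv_mul_cancel hb₀ hg_top])
      fun x y => (pull _ _).trans_le (mul_le_mul_right (H x y) _)
  rw [lintegral_const_mul _ hf, lintegral_const_mul _ hg, lintegral_const_mul _ hh, pull]
    at normalised
  rwa [ENNReal.mul_le_mul_iff_right (by simp [has_top, hbt_top, ENNReal.mul_eq_top])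
    (by simpa using hab₀)] at normalised

theorem lintegral_eq_iSup_lintegral_min {X : Type*} [MeasurableSpace X] {μ : Measure X}
    {f : X → ℝ≥0∞} (hf : Measurable f) : ∫⁻ x, f x ∂μ = ⨆ n : ℕ, ∫⁻ x, min (f x) n ∂μ := by
  rw [← lintegral_iSup (fun n => hf.min measurable_const)
    fun m n hmn x => min_le_min le_rfl (Nat.cast_le.2 hmn)]
  simp_rw [← inf_iSup_eq, ENNReal.iSup_natCast, inf_top_eq]

/-- The measure `μ` satisfies the Prékopa–Leindler inequality with exponents `s` and `t` with
respect to the binary mean `m`; no relation between `m` and the exponents is assumed. -/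
def HasPrekopaLeindler {X : Type*} [MeasurableSpace X] (μ : Measure X) (m : X → X → X)
    (s t : ℝ) : Prop :=
  ∀ f g h : X → ℝ≥0∞, Measurable f → Measurable g → Measurable h →
    (∀ x y, f x ^ s * g y ^ t ≤ h (m x y)) →
      (∫⁻ x, f x ∂μ) ^ s * (∫⁻ x, g x ∂μ) ^ t ≤ ∫⁻ x, h x ∂μ

theorem hasPrekopaLeindler_volume_real (hs : 0 < s) (ht : 0 < t) (hst : s + t = 1) :
    HasPrekopaLeindler (volume : Measure ℝ) (fun x y => s * x + t * y) s t := by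
  intro f g h hf hg hh H
  have iSup_rpow {r : ℝ} (hr : 0 < r) (a : ℕ → ℝ≥0∞) : (⨆ n, a n) ^ r = ⨆ n, a n ^ r :=
    (ENNReal.orderIsoRpow r hr).map_iSup a
  have iSup_min_ne_top (f : ℝ → ℝ≥0∞) (N : ℕ) : ⨆ x, min (f x) N ≠ ∞ :=
    ne_top_of_le_ne_top (ENNReal.natCast_ne_top N) (iSup_le fun x => min_le_right _ _)
  rw [lintegral_eq_iSup_lintegral_min hf, lintegral_eq_iSup_lintegral_min hg, iSup_rpow hs,
    iSup_rpow ht, ENNReal.iSup_mul]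
  refine iSup_le fun N => ?_
  rw [ENNReal.mul_iSup]
  refine iSup_le fun M => ?_
  refine lintegral_rpow_mul_lintegral_rpow_le_of_iSup_ne_top hs ht hst
    (hf.min measurable_const) (hg.min measurable_const) hh (iSup_min_ne_top f N)
    (iSup_min_ne_top g M) fun x y => le_trans ?_ (H x y)
  gcongr <;> exact min_le_left _ _

namespace HasPrekopaLeindler

variable {X Y : Type*} [MeasurableSpace X] [MeasurableSpace Y] {μ : Measure X} {ν : Measure Y}
  {m : X → X → X} {m' : Y → Y → Y}

theorem map (hμ : HasPrekopaLeindler μ m s t) {φ : X → Y} (hφ : Measurable φ)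
    (hm : ∀ x y, φ (m x y) = m' (φ x) (φ y)) : HasPrekopaLeindler (μ.map φ) m' s t := by
  intro f g h hf hg hh H
  simp_rw [lintegral_map hf hφ, lintegral_map hg hφ, lintegral_map hh hφ]
  exact hμ _ _ _ (hf.comp hφ) (hg.comp hφ) (hh.comp hφ) fun x y => (hm x y).symm ▸ H _ _

theorem withDensity (hμ : HasPrekopaLeindler μ m s t) (hs : 0 ≤ s) (ht : 0 ≤ t) {w : X → ℝ≥0∞}
    (hw : Measurable w) (hwm : ∀ x y, w x ^ s * w y ^ t ≤ w (m x y)) :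
    HasPrekopaLeindler (μ.withDensity w) m s t := by
  intro f g h hf hg hh H
  simp_rw [lintegral_withDensity_eq_lintegral_mul _ hw hf,
    lintegral_withDensity_eq_lintegral_mul _ hw hg, lintegral_withDensity_eq_lintegral_mul _ hw hh]
  refine hμ _ _ _ (hw.mul hf) (hw.mul hg) (hw.mul hh) fun x y => ?_
  simp only [Pi.mul_apply]
  rw [ENNReal.mul_rpow_of_nonneg _ _ hs, ENNReal.mul_rpow_of_nonneg _ _ ht, mul_mul_mul_comm]
  exact mul_le_mul' (hwm x y) (H x y)

theorem smul (hμ : HasPrekopaLeindler μ m s t) (hs : 0 ≤ s) (ht : 0 ≤ t) (hst : s + t = 1)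
    (c : ℝ≥0∞) : HasPrekopaLeindler (c • μ) m s t := by
  rw [← withDensity_const]
  refine hμ.withDensity hs ht measurable_const fun _ _ => ?_
  rw [← ENNReal.rpow_add_of_nonneg _ _ hs ht, hst, ENNReal.rpow_one]

theorem prod [SFinite ν] (hμ : HasPrekopaLeindler μ m s t) (hν : HasPrekopaLeindler ν m' s t) :
    HasPrekopaLeindler (μ.prod ν) (fun a b => (m a.1 b.1, m' a.2 b.2)) s t := by
  intro f g h hf hg hh H
  rw [lintegral_prod _ hf.aemeasurable, lintegral_prod _ hg.aemeasurable,
    lintegral_prod _ hh.aemeasurable]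
  refine hμ _ _ _ hf.lintegral_prod_right' hg.lintegral_prod_right' hh.lintegral_prod_right'
    fun x y => ?_
  exact hν _ _ _ (hf.comp measurable_prodMk_left) (hg.comp measurable_prodMk_left)
    (hh.comp measurable_prodMk_left) fun x' y' => H (x, x') (y, y')

theorem pi_fin {n : ℕ} {X : Fin n → Type*} [∀ i, MeasurableSpace (X i)]
    {μ : ∀ i, Measure (X i)} [∀ i, SigmaFinite (μ i)] {m : ∀ i, X i → X i → X i}
    (hμ : ∀ i, HasPrekopaLeindler (μ i) (m i) s t) :
    HasPrekopaLeindler (Measure.pi μ) (fun x y i => m i (x i) (y i)) s t := by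
  induction n with
  | zero =>
    intro f g h _ _ _ H
    simpa only [lintegral_unique, Measure.pi_empty_univ, mul_one, Subsingleton.elim _ default]
      using H default default
  | succ n ih =>
    have split := (measurePreserving_piFinSuccAbove μ 0).symm
    rw [← split.map_eq]
    refine ((hμ 0).prod (ih fun i => hμ (Fin.succAbove 0 i))).map split.measurable fun x y => ?_
    funext i
    cases i using Fin.cases <;> rfl

theorem pi {ι : Type*} [Fintype ι] {X : ι → Type*} [∀ i, MeasurableSpace (X i)]
    {μ : ∀ i, Measure (X i)} [∀ i, SigmaFinite (μ i)] {m : ∀ i, X i → X i → X i}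
    (hμ : ∀ i, HasPrekopaLeindler (μ i) (m i) s t) :
    HasPrekopaLeindler (Measure.pi μ) (fun x y i => m i (x i) (y i)) s t := by
  let e := (Fintype.equivFin ι).symm
  rw [← Measure.pi_map_piCongrLeft e]
  refine (pi_fin fun i => hμ (e i)).map (MeasurableEquiv.measurable _) fun x y => ?_
  funext i
  obtain ⟨j, rfl⟩ := e.surjective i
  simp only [MeasurableEquiv.coe_piCongrLeft, Equiv.piCongrLeft_apply_apply]

end HasPrekopaLeindler

theorem map_exp_withDensity_exp :
    (volume.withDensity fun u => ENNReal.ofReal (Real.exp u)).map Real.exp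
      = volume.restrict (Ioi (0 : ℝ)) := by
  refine Measure.ext_of_lintegral _ fun F hF => ?_
  have subst := lintegral_image_eq_lintegral_abs_deriv_mul MeasurableSet.univ
    (fun x _ => (Real.hasDerivAt_exp x).hasDerivWithinAt) Real.exp_injective.injOn F
  rw [image_univ, Real.range_exp, Measure.restrict_univ] at subst
  rw [lintegral_map hF Real.measurable_exp, subst,
    lintegral_withDensity_eq_lintegral_mul _ (by fun_prop) (by fun_prop)]
  simp only [Pi.mul_apply, abs_of_pos (Real.exp_pos _)]

theorem map_abs_volume :
    (volume : Measure ℝ).map (|·|) = (2 : ℝ≥0∞) • volume.restrict (Ioi 0) := by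
  refine Measure.ext_of_lintegral _ fun F hF => ?_
  have neg_part : ∫⁻ x in Iic (0 : ℝ), F |x| = ∫⁻ x in Ioi (0 : ℝ), F |x| := by
    have := (Measure.measurePreserving_neg (volume : Measure ℝ)).setLIntegral_comp_preimage_emb
      (MeasurableEquiv.neg ℝ).measurableEmbedding (fun x => F |x|) (Iio 0)
    simp only [abs_neg] at this
    rw [setLIntegral_congr Iio_ae_eq_Iic.symm, ← this]
    simp
  have pos_part : ∫⁻ x in Ioi (0 : ℝ), F |x| = ∫⁻ x in Ioi (0 : ℝ), F x :=
    setLIntegral_congr_fun measurableSet_Ioi fun x hx => by rw [abs_of_pos hx]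
  rw [lintegral_map hF (by fun_prop), ← lintegral_add_compl _ measurableSet_Ioi, compl_Ioi,
    neg_part, pos_part, lintegral_smul_measure, smul_eq_mul, two_mul]

theorem hasPrekopaLeindler_map_abs_volume (hs : 0 < s) (ht : 0 < t) (hst : s + t = 1) :
    HasPrekopaLeindler ((volume : Measure ℝ).map (|·|)) (fun x y => |x| ^ s * |y| ^ t) s t := by
  have log_linear : HasPrekopaLeindler (volume.withDensity fun u => ENNReal.ofReal (Real.exp u))
      (fun x y => s * x + t * y) s t := by
    refine (hasPrekopaLeindler_volume_real hs ht hst).withDensity hs.le ht.le (by fun_prop)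
      fun x y => le_of_eq ?_
    rw [ENNReal.ofReal_rpow_of_pos (Real.exp_pos _), ENNReal.ofReal_rpow_of_pos (Real.exp_pos _),
      ← ENNReal.ofReal_mul (by positivity), ← Real.exp_mul, ← Real.exp_mul, ← Real.exp_add,
      mul_comm x, mul_comm y]
  rw [map_abs_volume, ← map_exp_withDensity_exp]
  refine (log_linear.map Real.measurable_exp fun x y => ?_).smul hs.le ht.le hst 2
  simp only [abs_of_pos (Real.exp_pos _), ← Real.exp_mul, ← Real.exp_add, mul_comm s, mul_comm t]

end PrekopaLeindler

section Reflection

variable {ι : Type*} [Fintype ι] [DecidableEq ι]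

/-- The linear isometry that changes the sign of the coordinates in `I`. -/
def reflect (I : Finset ι) : (ι → ℝ) ≃ₗᵢ[ℝ] (ι → ℝ) where
  toLinearEquiv := LinearEquiv.piCongrRight fun i =>
    if i ∈ I then LinearEquiv.neg ℝ else LinearEquiv.refl ℝ ℝ
  norm_map' x := by
    simp only [Pi.norm_def]
    congr 2
    funext i
    by_cases hi : i ∈ I <;> simp [hi]

@[simp]
theorem reflect_apply (I : Finset ι) (x : ι → ℝ) (i : ι) :
    reflect I x i = if i ∈ I then -x i else x i := by
  change (if i ∈ I then LinearEquiv.neg ℝ else LinearEquiv.refl ℝ ℝ : ℝ ≃ₗ[ℝ] ℝ) (x i) = _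
  split_ifs <;> rfl

theorem reflect_reflect (I J : Finset ι) (x : ι → ℝ) :
    reflect I (reflect J x) = reflect (I ∆ J) x := by
  ext i
  by_cases hI : i ∈ I <;> by_cases hJ : i ∈ J <;> simp [hI, hJ, Finset.mem_symmDiff]

theorem reflect_comm (I J : Finset ι) (x : ι → ℝ) :
    reflect I (reflect J x) = reflect J (reflect I x) := by
  rw [reflect_reflect, symmDiff_comm, reflect_reflect]

theorem reflect_reflect_self (I : Finset ι) (x : ι → ℝ) : reflect I (reflect I x) = x := by
  ext i
  by_cases hI : i ∈ I <;> simp [hI]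

theorem reflect_univ (x : ι → ℝ) : reflect Finset.univ x = -x := by
  ext i
  simp

theorem reflect_compl (I : Finset ι) (x : ι → ℝ) : reflect Iᶜ x = -reflect I x := by
  ext i
  by_cases hI : i ∈ I <;> simp [hI]

theorem reflect_eq_neg_of_support {I : Finset ι} {v : ι → ℝ} (hv : ∀ i ∉ I, v i = 0) :
    reflect I v = -v := by
  ext i
  by_cases hI : i ∈ I <;> simp [hI, hv]

theorem dotProduct_reflect (I : Finset ι) (x u : ι → ℝ) : reflect I x ⬝ᵥ reflect I u = x ⬝ᵥ u :=
  Finset.sum_congr rfl fun i _ => by by_cases hI : i ∈ I <;> simp [hI]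

theorem abs_reflect_apply (I : Finset ι) (x : ι → ℝ) (i : ι) : |reflect I x i| = |x i| := by
  by_cases hI : i ∈ I <;> simp [hI]

/-- `F` does not change when the signs of the coordinates in `J` are changed. -/
def ReflectInvariant {α : Type*} (J : Finset ι) (F : (ι → ℝ) → α) : Prop :=
  ∀ x, F (reflect J x) = F x

theorem reflectInvariant_univ_iff {α : Type*} {F : (ι → ℝ) → α} :
    ReflectInvariant Finset.univ F ↔ F.Even := by
  simp only [ReflectInvariant, reflect_univ, Function.Even]

theorem reflectInvariant_empty {α : Type*} (F : (ι → ℝ) → α) : ReflectInvariant ∅ F :=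
  fun x => congrArg F (by ext; simp)

namespace ReflectInvariant

variable {α : Type*} {F : (ι → ℝ) → α} {I J : Finset ι}

theorem symmDiff (hI : ReflectInvariant I F) (hJ : ReflectInvariant J F) :
    ReflectInvariant (I ∆ J) F :=
  fun x => by rw [← reflect_reflect, hI, hJ]

theorem of_singletons (hF : ∀ i, ReflectInvariant {i} F) (J : Finset ι) :
    ReflectInvariant J F := by
  induction J using Finset.induction_on with
  | empty => exact reflectInvariant_empty F
  | insert i J hi ih =>
    have insert_eq : insert i J = {i} ∆ J := by
      rw [(Finset.disjoint_singleton_left.2 hi).symmDiff_eq_sup, Finset.sup_eq_union,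
        Finset.insert_eq]
    exact insert_eq ▸ (hF i).symmDiff ih

theorem apply_abs (hF : ∀ J, ReflectInvariant J F) (x : ι → ℝ) : F |x| = F x := by
  classical
  rw [← hF (Finset.univ.filter fun i => x i < 0) x]
  congr 1
  ext i
  rcases lt_or_ge (x i) 0 with hi | hi
  · simp [hi, abs_of_neg]
  · simp [hi.not_gt, abs_of_nonneg hi]

end ReflectInvariant

end Reflection

section Symmetrization

variable {ι : Type*} [Fintype ι] [DecidableEq ι] {I J : Finset ι} {F H : (ι → ℝ) → ℝ≥0∞}

/-- The hypothesis of the Prékopa–Leindler inequality in the coordinates in `I`, with exponents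
`1/2`, for the functions `F`, `F ∘ reflect I` and `H`. -/
def SymmDominates (I : Finset ι) (F H : (ι → ℝ) → ℝ≥0∞) : Prop :=
  ∀ y z, (∀ i ∉ I, y i = z i) →
    F y ^ (1 / 2 : ℝ) * F (reflect I z) ^ (1 / 2 : ℝ) ≤ H (midpoint ℝ y z)

/-- The symmetrization of `F` in the coordinates in `I`: the smallest function `H` such that
`SymmDominates I F H`. -/
def symmetrize (I : Finset ι) (F : (ι → ℝ) → ℝ≥0∞) (x : ι → ℝ) : ℝ≥0∞ :=
  ⨆ v : {v : ι → ℝ // ∀ i ∉ I, v i = 0},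
    F (x + v) ^ (1 / 2 : ℝ) * F (reflect I (x - v)) ^ (1 / 2 : ℝ)

theorem symmDominates_symmetrize (I : Finset ι) (F : (ι → ℝ) → ℝ≥0∞) :
    SymmDominates I F (symmetrize I F) := by
  intro y z hyz
  refine le_iSup_of_le ⟨(2⁻¹ : ℝ) • (y - z), fun i hi => by simp [hyz i hi]⟩ (le_of_eq ?_)
  have add_half : midpoint ℝ y z + (2⁻¹ : ℝ) • (y - z) = y := by
    ext i; simp [midpoint_eq_smul_add]; ring
  have sub_half : midpoint ℝ y z - (2⁻¹ : ℝ) • (y - z) = z := by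
    ext i; simp [midpoint_eq_smul_add]; ring
  simp only [add_half, sub_half]

theorem SymmDominates.rpow (h : SymmDominates I F H) {α : ℝ} (hα : 0 ≤ α) :
    SymmDominates I (fun x => F x ^ α) (fun x => H x ^ α) := by
  intro y z hyz
  calc (F y ^ α) ^ (1 / 2 : ℝ) * (F (reflect I z) ^ α) ^ (1 / 2 : ℝ)
      = (F y ^ (1 / 2 : ℝ) * F (reflect I z) ^ (1 / 2 : ℝ)) ^ α := by
        simp only [ENNReal.mul_rpow_of_nonneg _ _ hα, ← ENNReal.rpow_mul, mul_comm]
    _ ≤ H (midpoint ℝ y z) ^ α := ENNReal.rpow_le_rpow (h y z hyz) hα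

theorem SymmDominates.indicator (h : SymmDominates I F H) {s : Set (ι → ℝ)} (hs : Convex ℝ s)
    (hIs : ReflectInvariant I (· ∈ s)) : SymmDominates I (s.indicator F) (s.indicator H) := by
  intro y z hyz
  by_cases hy : y ∈ s
  · by_cases hz : z ∈ s
    · have hz' : reflect I z ∈ s := (hIs z).mpr hz
      rw [indicator_of_mem hy, indicator_of_mem hz', indicator_of_mem (hs.midpoint_mem hy hz)]
      exact h y z hyz
    · have hz' : reflect I z ∉ s := fun h => hz ((hIs z).mp h)
      simp [indicator_of_notMem hz']
  · simp [indicator_of_notMem hy]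

theorem ReflectInvariant.symmetrize (hF : ReflectInvariant J F) :
    ReflectInvariant J (symmetrize I F) := by
  intro x
  have reflect_support {v : ι → ℝ} (hv : ∀ i ∉ I, v i = 0) : ∀ i ∉ I, reflect J v i = 0 :=
    fun i hi => by simp [hv i hi]
  let e : {v : ι → ℝ // ∀ i ∉ I, v i = 0} ≃ {v : ι → ℝ // ∀ i ∉ I, v i = 0} :=
    { toFun v := ⟨reflect J v, reflect_support v.2⟩
      invFun v := ⟨reflect J v, reflect_support v.2⟩
      left_inv v := Subtype.ext (reflect_reflect_self J v)
      right_inv v := Subtype.ext (reflect_reflect_self J v) }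
  refine (e.iSup_congr fun v => ?_).symm
  change F (reflect J x + reflect J v) ^ _ * F (reflect I (reflect J x - reflect J v)) ^ _ = _
  rw [← map_add, ← map_sub, hF, reflect_comm, hF]

theorem reflectInvariant_symmetrize_self (I : Finset ι) (F : (ι → ℝ) → ℝ≥0∞) :
    ReflectInvariant I (symmetrize I F) := by
  refine fun x => iSup_congr fun v => ?_
  have hv : reflect I (v : ι → ℝ) = -v := reflect_eq_neg_of_support v.2
  simp only [map_sub, reflect_reflect_self, hv, sub_neg_eq_add, mul_comm]

theorem lowerSemicontinuous_ennreal_mul {X : Type*} [TopologicalSpace X] {f g : X → ℝ≥0∞}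
    (hf : LowerSemicontinuous f) (hg : LowerSemicontinuous g) :
    LowerSemicontinuous fun x => f x * g x := by
  intro x c hc
  obtain ⟨a, ha, b, hb, hab⟩ : ∃ a < f x, ∃ b < g x, c < a * b := by
    by_contra! hle
    exact hc.not_ge (ENNReal.mul_le_of_forall_lt hle)
  filter_upwards [hf x a ha, hg x b hb] with y hay hby
  exact hab.trans_le (mul_le_mul' hay.le hby.le)

theorem lowerSemicontinuous_symmetrize (I : Finset ι) (hF : LowerSemicontinuous F) :
    LowerSemicontinuous (symmetrize I F) := by
  have sqrt_comp {φ : (ι → ℝ) → ι → ℝ} (hφ : Continuous φ) :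
      LowerSemicontinuous fun x => F (φ x) ^ (1 / 2 : ℝ) :=
    ENNReal.continuous_rpow_const.comp_lowerSemicontinuous (hF.comp hφ)
      (ENNReal.monotone_rpow_of_nonneg (by norm_num))
  exact lowerSemicontinuous_iSup fun v => lowerSemicontinuous_ennreal_mul
    (sqrt_comp (by fun_prop)) (sqrt_comp ((reflect I).continuous.comp (by fun_prop)))

end Symmetrization

section SymmMonotone

variable {ι : Type*} [Fintype ι] [DecidableEq ι] {I : Finset ι} {ν : Measure (ι → ℝ)}

/-- Symmetrization in the coordinates in `I` does not decrease integrals with respect to `ν`. -/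
def SymmMonotone (I : Finset ι) (ν : Measure (ι → ℝ)) : Prop :=
  ∀ F H : (ι → ℝ) → ℝ≥0∞, Measurable F → Measurable H → SymmDominates I F H →
    ∫⁻ x, F x ∂ν ≤ ∫⁻ x, H x ∂ν

theorem HasPrekopaLeindler.lintegral_le_of_even {E : Type*} [AddCommGroup E] [Module ℝ E]
    [MeasurableSpace E] [MeasurableNeg E] {μ : Measure E} [μ.IsNegInvariant]
    (hμ : HasPrekopaLeindler μ (midpoint ℝ) (1 / 2) (1 / 2)) {f h : E → ℝ≥0∞}
    (hf : Measurable f) (hh : Measurable h)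
    (H : ∀ x y, f x ^ (1 / 2 : ℝ) * f (-y) ^ (1 / 2 : ℝ) ≤ h (midpoint ℝ x y)) :
    ∫⁻ x, f x ∂μ ≤ ∫⁻ x, h x ∂μ := by
  have := hμ f (fun x => f (-x)) h hf (hf.comp measurable_neg) hh H
  rwa [lintegral_neg_eq_self, ← ENNReal.rpow_add_of_nonneg _ _ (by norm_num) (by norm_num),
    add_halves, ENNReal.rpow_one] at this

theorem hasPrekopaLeindler_volume_pi (κ : Type*) [Fintype κ] :
    HasPrekopaLeindler (volume : Measure (κ → ℝ)) (midpoint ℝ) (1 / 2) (1 / 2) := by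
  have midpoint_eq : (midpoint ℝ : (κ → ℝ) → (κ → ℝ) → κ → ℝ)
      = fun x y i => 1 / 2 * x i + 1 / 2 * y i := by
    ext x y i
    simp [midpoint_eq_smul_add, mul_add]
  rw [midpoint_eq]
  exact HasPrekopaLeindler.pi fun _ =>
    hasPrekopaLeindler_volume_real (by norm_num) (by norm_num) (by norm_num)

theorem symmMonotone_volume (I : Finset ι) : SymmMonotone I volume := by
  intro F H hF hH hFH
  let e := MeasurableEquiv.piEquivPiSubtypeProd (fun _ : ι => ℝ) (· ∈ I)
  have he : MeasurePreserving e.symm := by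
    convert (volume_preserving_piEquivPiSubtypeProd (fun _ : ι => ℝ) (· ∈ I)).symm
  have e_apply (a b i) : e.symm (a, b) i = if hi : i ∈ I then a ⟨i, hi⟩ else b ⟨i, hi⟩ := rfl
  have hFe : Measurable fun z => F (e.symm z) := hF.comp e.symm.measurable
  have hHe : Measurable fun z => H (e.symm z) := hH.comp e.symm.measurable
  rw [← he.lintegral_comp hF, ← he.lintegral_comp hH, Measure.volume_eq_prod,
    lintegral_prod_symm' _ hFe, lintegral_prod_symm' _ hHe]
  refine lintegral_mono fun b => (hasPrekopaLeindler_volume_pi _).lintegral_le_of_even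
    (hFe.comp measurable_prodMk_right) (hHe.comp measurable_prodMk_right) fun x y => ?_
  have e_neg : e.symm (-y, b) = reflect I (e.symm (y, b)) := by
    ext i
    by_cases hi : i ∈ I <;> simp [e_apply, hi]
  have e_midpoint :
      e.symm (midpoint ℝ x y, b) = midpoint ℝ (e.symm (x, b)) (e.symm (y, b)) := by
    ext i
    by_cases hi : i ∈ I <;> simp [e_apply, hi, pi_midpoint_apply]
  simp only [e_neg, e_midpoint]
  exact hFH _ _ fun i hi => by simp [e_apply, hi]

namespace SymmMonotone

theorem smul (hν : SymmMonotone I ν) (c : ℝ≥0∞) : SymmMonotone I (c • ν) := by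
  intro F H hF hH hFH
  simp only [lintegral_smul_measure]
  exact mul_le_mul_right (hν F H hF hH hFH) c

theorem withDensity [SFinite ν] (hν : SymmMonotone I ν) {w : (ι → ℝ) → ℝ≥0∞} (hw : Measurable w)
    (hIw : ReflectInvariant I w) (hwc : QuasiconcaveOn ℝ univ w) :
    SymmMonotone I (ν.withDensity w) := by
  intro F H hF hH hFH
  have hlt (t : ℝ) : MeasurableSet {x | ENNReal.ofReal t < w x} := measurableSet_lt (by simp) hw
  -- The layer cake formula for `w` replaces the weight by the convex sets `{t < w}`.
  have layers {F : (ι → ℝ) → ℝ≥0∞} (hF : Measurable F) : ∫⁻ x, F x ∂ν.withDensity w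
      = ∫⁻ t in Ioi (0 : ℝ), ∫⁻ x, {x | ENNReal.ofReal t < w x}.indicator F x ∂ν := by
    rw [lintegral_withDensity_eq_lintegral_mul _ hw hF, mul_comm,
      ← lintegral_withDensity_eq_lintegral_mul _ hF hw,
      lintegral_eq_lintegral_measure_ofReal_lt hw]
    simp only [withDensity_apply _ (hlt _), lintegral_indicator (hlt _)]
  rw [layers hF, layers hH]
  refine lintegral_mono fun t => hν _ _ (hF.indicator (hlt t)) (hH.indicator (hlt t))
    (hFH.indicator ?_ fun x => ?_)
  · simpa using hwc.convex_gt (ENNReal.ofReal t)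
  · simp only [mem_ofPred_eq, hIw x]

theorem withDensity_prod {κ : Type*} [SFinite ν] (hν : SymmMonotone I ν)
    {w : κ → (ι → ℝ) → ℝ≥0∞} {s : Finset κ} (hw : ∀ j ∈ s, Measurable (w j))
    (hIw : ∀ j ∈ s, ReflectInvariant I (w j)) (hwc : ∀ j ∈ s, QuasiconcaveOn ℝ univ (w j)) :
    SymmMonotone I (ν.withDensity (∏ j ∈ s, w j)) := by
  classical
  induction s using Finset.induction_on with
  | empty => rwa [Finset.prod_empty, withDensity_one]
  | insert j s hj ih =>
    simp only [Finset.forall_mem_insert] at hw hIw hwc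
    have hprod : Measurable (∏ k ∈ s, w k) := by
      simpa only [Finset.prod_fn] using Finset.measurable_prod s hw.2
    rw [Finset.prod_insert hj, mul_comm, withDensity_mul _ hprod hw.1]
    exact (ih hw.2 hIw.2 hwc.2).withDensity hw.1 hIw.1 hwc.1

end SymmMonotone

theorem symmMonotone_dirac_zero (I : Finset ι) : SymmMonotone I (Measure.dirac 0) := by
  intro F H hF hH hFH
  have := hFH 0 0 fun _ _ => rfl
  rwa [map_zero, midpoint_self, ← ENNReal.rpow_add_of_nonneg _ _ (by norm_num) (by norm_num),
    add_halves, ENNReal.rpow_one, ← lintegral_dirac' 0 hF, ← lintegral_dirac' 0 hH] at this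

end SymmMonotone

section PolarPair

variable {ι : Type*} [Fintype ι] [DecidableEq ι] {S : Set (Finset ι)} {C : ℝ≥0∞}
  {F G : (ι → ℝ) → ℝ≥0∞}

/-- The product `F x * G u` is at most `C * e^{-⟨x, u⟩}`; for `C = 1` and `F = e^{-Φ}` this says
that `G ≤ e^{-Φ^*}`. -/
def IsPolarPair {ι : Type*} [Fintype ι] (C : ℝ≥0∞) (F G : (ι → ℝ) → ℝ≥0∞) : Prop :=
  ∀ x u, F x * G u ≤ C * ENNReal.ofReal (Real.exp (-(x ⬝ᵥ u)))

theorem sqrt_mul_sqrt_le_of_polar {r₁ r₂ r : ℝ} (hr : r₁ + r₂ = r + r) {a₁ b₁ a₂ b₂ : ℝ≥0∞}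
    (h₁ : a₁ * b₁ ≤ C * ENNReal.ofReal (Real.exp (-r₁)))
    (h₂ : a₂ * b₂ ≤ C * ENNReal.ofReal (Real.exp (-r₂))) :
    a₁ ^ (1 / 2 : ℝ) * a₂ ^ (1 / 2 : ℝ) * (b₁ ^ (1 / 2 : ℝ) * b₂ ^ (1 / 2 : ℝ))
      ≤ C * ENNReal.ofReal (Real.exp (-r)) := by
  have hexp : ENNReal.ofReal (Real.exp (-r₁)) * ENNReal.ofReal (Real.exp (-r₂))
      = ENNReal.ofReal (Real.exp (-r)) * ENNReal.ofReal (Real.exp (-r)) := by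
    simp only [← ENNReal.ofReal_mul (Real.exp_nonneg _), ← Real.exp_add]
    congr 2
    linarith
  calc a₁ ^ (1 / 2 : ℝ) * a₂ ^ (1 / 2 : ℝ) * (b₁ ^ (1 / 2 : ℝ) * b₂ ^ (1 / 2 : ℝ))
      = ((a₁ * b₁) * (a₂ * b₂)) ^ (1 / 2 : ℝ) := by
        simp only [ENNReal.mul_rpow_of_nonneg _ _ (show (0 : ℝ) ≤ 1 / 2 by norm_num)]
        ring
    _ ≤ ((C * ENNReal.ofReal (Real.exp (-r₁))) * (C * ENNReal.ofReal (Real.exp (-r₂))))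
          ^ (1 / 2 : ℝ) := by gcongr
    _ = C * ENNReal.ofReal (Real.exp (-r)) := by
        rw [mul_mul_mul_comm, hexp, ← mul_mul_mul_comm,
          ENNReal.mul_rpow_of_nonneg _ _ (by norm_num),
          ← ENNReal.rpow_add_of_nonneg _ _ (by norm_num) (by norm_num), add_halves,
          ENNReal.rpow_one]

theorem IsPolarPair.symmetrize (h : IsPolarPair C F G) (hG : G.Even) (I : Finset ι) :
    IsPolarPair C (symmetrize I F) (symmetrize Iᶜ G) := by
  intro x u
  simp only [BlaschkeSantalo.symmetrize, ENNReal.iSup_mul, ENNReal.mul_iSup, iSup_le_iff]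
  rintro ⟨v', hv'⟩ ⟨v, hv⟩
  have hG_reflect : G (reflect Iᶜ (u - v')) = G (-reflect Iᶜ (u - v')) := (hG _).symm
  have orthogonal : v ⬝ᵥ v' = 0 := Finset.sum_eq_zero fun i _ => by
    by_cases hi : i ∈ I
    · simp [hv' i (by simpa using hi)]
    · simp [hv i hi]
  rw [hG_reflect, reflect_compl, neg_neg]
  refine sqrt_mul_sqrt_le_of_polar ?_ (h _ _) (h _ _)
  simp only [dotProduct_reflect, add_dotProduct, dotProduct_add, sub_dotProduct, dotProduct_sub,
    orthogonal]
  ring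

/-- A polar pair of lower semicontinuous functions that are invariant under the reflections
`reflect J` with `J ∈ S`. -/
structure IsSymmetricPolarPair (S : Set (Finset ι)) (C : ℝ≥0∞) (F G : (ι → ℝ) → ℝ≥0∞) :
    Prop where
  polar : IsPolarPair C F G
  lsc_left : LowerSemicontinuous F
  lsc_right : LowerSemicontinuous G
  invariant_left : ∀ J ∈ S, ReflectInvariant J F
  invariant_right : ∀ J ∈ S, ReflectInvariant J G

namespace IsSymmetricPolarPair

theorem symmetrize (h : IsSymmetricPolarPair S C F G) (huniv : Finset.univ ∈ S) (I : Finset ι) :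
    IsSymmetricPolarPair (insert I S) C (symmetrize I F) (symmetrize Iᶜ G) where
  polar := h.polar.symmetrize (reflectInvariant_univ_iff.1 (h.invariant_right _ huniv)) I
  lsc_left := lowerSemicontinuous_symmetrize I h.lsc_left
  lsc_right := lowerSemicontinuous_symmetrize Iᶜ h.lsc_right
  invariant_left := forall_mem_insert.2
    ⟨reflectInvariant_symmetrize_self I F, fun J hJ => (h.invariant_left J hJ).symmetrize⟩
  invariant_right := by
    have hS : ∀ J ∈ S, ReflectInvariant J (BlaschkeSantalo.symmetrize Iᶜ G) :=
      fun J hJ => (h.invariant_right J hJ).symmetrize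
    have compl_symmDiff_univ : Iᶜ ∆ Finset.univ = I := by
      rw [← Finset.top_eq_univ, symmDiff_top, hnot_eq_compl, compl_compl]
    refine forall_mem_insert.2 ⟨?_, hS⟩
    have := (reflectInvariant_symmetrize_self Iᶜ G).symmDiff (hS _ huniv)
    rwa [compl_symmDiff_univ] at this

theorem of_singletons (h : IsSymmetricPolarPair S C F G) (hS : ∀ i, {i} ∈ S) :
    IsSymmetricPolarPair univ C F G where
  __ := h
  invariant_left J _ := .of_singletons (fun i => h.invariant_left _ (hS i)) J
  invariant_right J _ := .of_singletons (fun i => h.invariant_right _ (hS i)) J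

theorem exists_univ (h : IsSymmetricPolarPair {Finset.univ} C F G) {ν : Measure (ι → ℝ)}
    (hν : ∀ I, SymmMonotone I ν) {α : ℝ} (hα : 0 ≤ α) :
    ∃ F' G', IsSymmetricPolarPair univ C F' G' ∧ ∫⁻ x, F x ≤ ∫⁻ x, F' x ∧
      ∫⁻ y, G y ^ α ∂ν ≤ ∫⁻ y, G' y ^ α ∂ν := by
  suffices partially : ∀ T : Finset ι, ∃ F' G',
      IsSymmetricPolarPair (insert Finset.univ {J | ∃ i ∈ T, J = {i}}) C F' G' ∧
      ∫⁻ x, F x ≤ ∫⁻ x, F' x ∧ ∫⁻ y, G y ^ α ∂ν ≤ ∫⁻ y, G' y ^ α ∂ν by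
    obtain ⟨F', G', hFG, hle⟩ := partially Finset.univ
    exact ⟨F', G', hFG.of_singletons fun i => Or.inr ⟨i, Finset.mem_univ i, rfl⟩, hle⟩
  intro T
  induction T using Finset.induction_on with
  | empty => exact ⟨F, G, by simpa using h, le_rfl, le_rfl⟩
  | insert i T _ ih =>
    obtain ⟨F', G', hFG, hF, hG⟩ := ih
    have hsymm := hFG.symmetrize (mem_insert _ _) {i}
    have insert_comm : insert Finset.univ {J : Finset ι | ∃ k ∈ insert i T, J = {k}}
        = insert {i} (insert Finset.univ {J | ∃ k ∈ T, J = {k}}) := by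
      ext J
      simp only [Finset.exists_mem_insert, mem_insert_iff, mem_ofPred_eq]
      tauto
    refine ⟨_, _, insert_comm ▸ hsymm, hF.trans ?_, hG.trans ?_⟩
    · exact symmMonotone_volume {i} _ _ hFG.lsc_left.measurable hsymm.lsc_left.measurable
        (symmDominates_symmetrize _ _)
    · exact hν {i}ᶜ _ _ (hFG.lsc_right.measurable.pow_const α)
        (hsymm.lsc_right.measurable.pow_const α) ((symmDominates_symmetrize _ _).rpow hα)

end IsSymmetricPolarPair

end PolarPair

section SantaloBound

variable {ι : Type*} [Fintype ι] {p : ℝ} {V : (ι → ℝ) → ℝ} {T : (ι → ℝ) → ι → ℝ} {C : ℝ≥0∞}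
  {F G : (ι → ℝ) → ℝ≥0∞}

/-- The inequality `GeneralizedBS` with `e^{-Φ}`, `e^{-Φ^*}` and `∇V` replaced by arbitrary `F`, `G`
and `T`, and with the constant `C` of `IsPolarPair` on the right. -/
def SantaloBound (p : ℝ) (V : (ι → ℝ) → ℝ) (T : (ι → ℝ) → ι → ℝ) (C : ℝ≥0∞)
    (F G : (ι → ℝ) → ℝ≥0∞) : Prop :=
  (∫⁻ x, F x) * (∫⁻ y, G (T y) ^ (1 / (p - 1))) ^ (p - 1)
    ≤ C * (∫⁻ x, ENNReal.ofReal (Real.exp (-V x))) ^ p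

/-- The properties of an unconditional potential `V` and its gradient `T` that make the
Prékopa–Leindler inequality for geometric means applicable to polar pairs. -/
structure IsSantaloPotential [DecidableEq ι] (p : ℝ) (V : (ι → ℝ) → ℝ)
    (T : (ι → ℝ) → ι → ℝ) : Prop where
  measurable_potential : Measurable V
  measurable_gradient : Measurable T
  potential_reflect : ∀ J, ReflectInvariant J V
  gradient_reflect : ∀ J x, T (reflect J x) = reflect J (T x)
  potential_geom_mean_le : ∀ x y : ι → ℝ,
    V (fun i => |x i| ^ (1 / p) * |y i| ^ ((p - 1) / p)) ≤ 1 / p * (|x| ⬝ᵥ T |y|)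

theorem sigmaFinite_map_abs_volume : SigmaFinite ((volume : Measure ℝ).map (|·|)) := by
  rw [map_abs_volume]
  exact inferInstanceAs (SigmaFinite ((2 : NNReal) • volume.restrict (Ioi (0 : ℝ))))

theorem lintegral_pi_map_abs_volume [DecidableEq ι] (hF : Measurable F)
    (hFi : ∀ J, ReflectInvariant J F) :
    ∫⁻ x, F x ∂Measure.pi (fun _ : ι => (volume : Measure ℝ).map (|·|)) = ∫⁻ x, F x := by
  have := sigmaFinite_map_abs_volume
  rw [← Measure.pi_map_pi fun _ => (by fun_prop), lintegral_map hF (by fun_prop), ← volume_pi]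
  exact lintegral_congr (ReflectInvariant.apply_abs hFi)

theorem IsPolarPair.rpow_mul_rpow_le (hp : 1 < p) (h : IsPolarPair C F G) {x u : ι → ℝ} {v : ℝ}
    (hv : v ≤ 1 / p * (x ⬝ᵥ u)) :
    F x ^ (1 / p) * (G u ^ (1 / (p - 1))) ^ ((p - 1) / p)
      ≤ C ^ (1 / p) * ENNReal.ofReal (Real.exp (-v)) := by
  have hp1 : 0 < p - 1 := by linarith
  calc F x ^ (1 / p) * (G u ^ (1 / (p - 1))) ^ ((p - 1) / p)
      = (F x * G u) ^ (1 / p) := by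
        rw [← ENNReal.rpow_mul, ENNReal.mul_rpow_of_nonneg _ _ (by positivity)]
        congr 2
        field_simp
    _ ≤ (C * ENNReal.ofReal (Real.exp (-(x ⬝ᵥ u)))) ^ (1 / p) := by
        exact ENNReal.rpow_le_rpow (h x u) (by positivity)
    _ = C ^ (1 / p) * ENNReal.ofReal (Real.exp (-(1 / p * (x ⬝ᵥ u)))) := by
        rw [ENNReal.mul_rpow_of_nonneg _ _ (by positivity),
          ENNReal.ofReal_rpow_of_pos (Real.exp_pos _), ← Real.exp_mul, neg_mul, mul_comm (_ ⬝ᵥ _)]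
    _ ≤ C ^ (1 / p) * ENNReal.ofReal (Real.exp (-v)) := by gcongr

namespace IsSantaloPotential

variable [DecidableEq ι]

theorem santaloBound_of_invariant (hp : 1 < p) (hV : IsSantaloPotential p V T)
    (h : IsSymmetricPolarPair univ C F G) : SantaloBound p V T C F G := by
  have := sigmaFinite_map_abs_volume
  have hp1 : 0 < p - 1 := by linarith
  have hp0 : 0 < p := by linarith
  have hF := h.lsc_left.measurable
  have hFi (J) := h.invariant_left J (mem_univ J)
  have hg : Measurable fun y => G (T y) ^ (1 / (p - 1)) :=
    (h.lsc_right.measurable.comp hV.measurable_gradient).pow_const _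
  have hgi (J) : ReflectInvariant J fun y => G (T y) ^ (1 / (p - 1)) := fun y => by
    simp only [hV.gradient_reflect, h.invariant_right J (mem_univ J) (T y)]
  have hE : Measurable fun x => ENNReal.ofReal (Real.exp (-V x)) :=
    ENNReal.measurable_ofReal.comp (Real.measurable_exp.comp hV.measurable_potential.neg)
  have hEi (J) : ReflectInvariant J fun x => ENNReal.ofReal (Real.exp (-V x)) := fun x => by
    simp only [hV.potential_reflect J x]
  have pointwise (x y : ι → ℝ) : F x ^ (1 / p) * (G (T y) ^ (1 / (p - 1))) ^ ((p - 1) / p)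
      ≤ C ^ (1 / p) * ENNReal.ofReal
        (Real.exp (-V fun i => |x i| ^ (1 / p) * |y i| ^ ((p - 1) / p))) := by
    rw [← ReflectInvariant.apply_abs hFi x, ← ReflectInvariant.apply_abs hgi y]
    exact h.polar.rpow_mul_rpow_le hp (hV.potential_geom_mean_le x y)
  have key := HasPrekopaLeindler.pi (fun _ : ι => hasPrekopaLeindler_map_abs_volume
      (one_div_pos.2 hp0) (div_pos hp1 hp0) (by field_simp; ring))
    _ _ _ hF hg (hE.const_mul (C ^ (1 / p))) pointwise
  rw [lintegral_const_mul _ hE, lintegral_pi_map_abs_volume hF hFi,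
    lintegral_pi_map_abs_volume hg hgi, lintegral_pi_map_abs_volume hE hEi] at key
  have := ENNReal.rpow_le_rpow key hp0.le
  rwa [ENNReal.mul_rpow_of_nonneg _ _ hp0.le, ENNReal.mul_rpow_of_nonneg _ _ hp0.le,
    ← ENNReal.rpow_mul, ← ENNReal.rpow_mul, ← ENNReal.rpow_mul, one_div_mul_cancel hp0.ne',
    div_mul_cancel₀ _ hp0.ne', ENNReal.rpow_one, ENNReal.rpow_one] at this

theorem santaloBound_of_even (hp : 1 < p) (hV : IsSantaloPotential p V T)
    (hT : ∀ I, SymmMonotone I (volume.map T)) (h : IsSymmetricPolarPair {Finset.univ} C F G) :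
    SantaloBound p V T C F G := by
  obtain ⟨F', G', h', hF, hG⟩ := h.exists_univ hT (one_div_pos.2 (sub_pos.2 hp)).le
  rw [lintegral_map (h.lsc_right.measurable.pow_const _) hV.measurable_gradient,
    lintegral_map (h'.lsc_right.measurable.pow_const _) hV.measurable_gradient] at hG
  refine le_trans ?_ (hV.santaloBound_of_invariant hp h')
  gcongr

end IsSantaloPotential

end SantaloBound

section Thicken

variable {ι : Type*} [Fintype ι] {p δ R : ℝ} {C : ℝ≥0∞} {F G : (ι → ℝ) → ℝ≥0∞}

/-- The lower semicontinuous function whose value at `x` is the supremum of `F` over the open ball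
with centre `x` and radius `δ`. -/
def thicken (δ : ℝ) (F : (ι → ℝ) → ℝ≥0∞) (x : ι → ℝ) : ℝ≥0∞ :=
  ⨆ x' ∈ Metric.ball x δ, F x'

theorem lowerSemicontinuous_thicken (δ : ℝ) (F : (ι → ℝ) → ℝ≥0∞) :
    LowerSemicontinuous (thicken δ F) := by
  intro x a ha
  simp only [thicken, lt_iSup_iff] at ha ⊢
  obtain ⟨x', hx', hax'⟩ := ha
  filter_upwards [Metric.isOpen_ball.mem_nhds (Metric.mem_ball_comm.1 hx')] with y hy
  exact ⟨x', Metric.mem_ball_comm.1 hy, hax'⟩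

theorem le_thicken (hδ : 0 < δ) (F : (ι → ℝ) → ℝ≥0∞) (x : ι → ℝ) : F x ≤ thicken δ F x :=
  le_iSup₂_of_le x (Metric.mem_ball_self hδ) le_rfl

theorem ReflectInvariant.thicken [DecidableEq ι] {J : Finset ι} (hF : ReflectInvariant J F)
    (δ : ℝ) : ReflectInvariant J (thicken δ F) := by
  intro x
  refine ((reflect J).toEquiv.iSup_congr fun v => ?_).symm
  simp [Metric.mem_ball, hF v]

theorem ReflectInvariant.indicator_closedBall [DecidableEq ι] {J : Finset ι}
    (hF : ReflectInvariant J F) (R : ℝ) :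
    ReflectInvariant J ((Metric.closedBall 0 R).indicator F) := by
  intro x
  simp only [indicator, mem_closedBall_zero_iff, LinearIsometryEquiv.norm_map, hF x]

theorem dotProduct_le_card_mul_norm_mul_norm (x u : ι → ℝ) :
    x ⬝ᵥ u ≤ Fintype.card ι * (‖x‖ * ‖u‖) := by
  rw [dotProduct, ← nsmul_eq_mul]
  refine Finset.sum_le_card_nsmul _ _ _ fun i _ => (le_abs_self _).trans ?_
  rw [abs_mul]
  exact mul_le_mul (norm_le_pi_norm x i) (norm_le_pi_norm u i) (abs_nonneg _) (norm_nonneg _)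

theorem dotProduct_sub_dotProduct_le (hδ : 0 ≤ δ) {x x' u u' : ι → ℝ} (hx : ‖x - x'‖ ≤ δ)
    (hu : ‖u - u'‖ ≤ δ) (hx' : ‖x'‖ ≤ R) (hu' : ‖u'‖ ≤ R) :
    x ⬝ᵥ u - x' ⬝ᵥ u' ≤ Fintype.card ι * (δ * (2 * R + δ)) := by
  have hu_norm : ‖u‖ ≤ R + δ := by linarith [norm_le_norm_add_norm_sub' u u']
  calc x ⬝ᵥ u - x' ⬝ᵥ u' = (x - x') ⬝ᵥ u + x' ⬝ᵥ (u - u') := by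
        rw [sub_dotProduct, dotProduct_sub]; ring
    _ ≤ Fintype.card ι * (‖x - x'‖ * ‖u‖) + Fintype.card ι * (‖x'‖ * ‖u - u'‖) :=
        add_le_add (dotProduct_le_card_mul_norm_mul_norm _ _)
          (dotProduct_le_card_mul_norm_mul_norm _ _)
    _ ≤ Fintype.card ι * (δ * (R + δ)) + Fintype.card ι * (R * δ) := by
        gcongr
        exact (norm_nonneg _).trans hx'
    _ = Fintype.card ι * (δ * (2 * R + δ)) := by ring

theorem IsPolarPair.thicken_indicator_closedBall (h : IsPolarPair C F G) (hδ : 0 ≤ δ) (R : ℝ) :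
    IsPolarPair (C * ENNReal.ofReal (Real.exp (Fintype.card ι * (δ * (2 * R + δ)))))
      (thicken δ ((Metric.closedBall 0 R).indicator F))
      (thicken δ ((Metric.closedBall 0 R).indicator G)) := by
  intro x u
  simp only [thicken, ENNReal.iSup_mul, ENNReal.mul_iSup, iSup_le_iff]
  intro u' hu' x' hx'
  by_cases hx'R : x' ∈ Metric.closedBall 0 R
  swap
  · simp [indicator_of_notMem hx'R]
  by_cases hu'R : u' ∈ Metric.closedBall 0 R
  swap
  · simp [indicator_of_notMem hu'R]
  rw [indicator_of_mem hx'R, indicator_of_mem hu'R, mul_assoc,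
    ← ENNReal.ofReal_mul (Real.exp_nonneg _), ← Real.exp_add]
  refine (h x' u').trans ?_
  gcongr
  have := dotProduct_sub_dotProduct_le hδ (mem_ball_iff_norm'.1 hx').le
    (mem_ball_iff_norm'.1 hu').le (mem_closedBall_zero_iff.1 hx'R) (mem_closedBall_zero_iff.1 hu'R)
  linarith

theorem iSup_lintegral_indicator_closedBall_comp {X : Type*} [MeasurableSpace X] {μ : Measure X}
    {g : X → ι → ℝ} (hg : Measurable g) (F : (ι → ℝ) → ℝ≥0∞) :
    ⨆ k : ℕ, ∫⁻ x, (Metric.closedBall 0 (k : ℝ)).indicator F (g x) ∂μ = ∫⁻ x, F (g x) ∂μ := by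
  have as_setLIntegral (k : ℕ) : ∫⁻ x, (Metric.closedBall 0 (k : ℝ)).indicator F (g x) ∂μ
      = ∫⁻ x in g ⁻¹' Metric.closedBall 0 k, F (g x) ∂μ := by
    rw [← lintegral_indicator (hg Metric.isClosed_closedBall.measurableSet)]
    rfl
  have monotone_preimage : Monotone fun k : ℕ => g ⁻¹' Metric.closedBall 0 (k : ℝ) :=
    fun k l hkl => preimage_mono (Metric.closedBall_subset_closedBall (Nat.cast_le.2 hkl))
  simp only [as_setLIntegral]
  rw [← setLIntegral_iUnion_of_directed _ monotone_preimage.directed_le, ← preimage_iUnion,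
    Metric.iUnion_closedBall_nat, preimage_univ, Measure.restrict_univ]

theorem SantaloBound.of_indicator_closedBall {V : (ι → ℝ) → ℝ} {T : (ι → ℝ) → ι → ℝ}
    (hp : 1 < p) (hT : Measurable T)
    (h : ∀ k : ℕ, SantaloBound p V T C ((Metric.closedBall 0 k).indicator F)
      ((Metric.closedBall 0 k).indicator G)) :
    SantaloBound p V T C F G := by
  have hp1 : 0 < p - 1 := sub_pos.2 hp
  have indicator_rpow (k : ℕ) :
      (Metric.closedBall 0 (k : ℝ)).indicator (fun y => G y ^ (1 / (p - 1))) =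
        fun y => (Metric.closedBall 0 (k : ℝ)).indicator G y ^ (1 / (p - 1)) :=
    indicator_comp_of_zero (g := fun a : ℝ≥0∞ => a ^ (1 / (p - 1)))
      (ENNReal.zero_rpow_of_pos (one_div_pos.2 hp1))
  have iSup_rpow (a : ℕ → ℝ≥0∞) : (⨆ k, a k) ^ (p - 1) = ⨆ k, a k ^ (p - 1) :=
    (ENNReal.orderIsoRpow (p - 1) hp1).map_iSup a
  unfold SantaloBound at h ⊢
  rw [← iSup_lintegral_indicator_closedBall_comp (g := fun x => x) measurable_id F,
    ← iSup_lintegral_indicator_closedBall_comp hT fun y => G y ^ (1 / (p - 1)), iSup_rpow]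
  simp only [indicator_rpow, ENNReal.iSup_mul, ENNReal.mul_iSup, iSup_le_iff]
  intro l k
  refine le_trans ?_ (h (max k l))
  gcongr
  exacts [le_max_left k l, le_max_right k l]

theorem SantaloBound.of_forall_isSymmetricPolarPair [DecidableEq ι] {V : (ι → ℝ) → ℝ}
    {T : (ι → ℝ) → ι → ℝ} {S : Set (Finset ι)} (hp : 1 < p) (hT : Measurable T)
    (H : ∀ C F G, IsSymmetricPolarPair S C F G → SantaloBound p V T C F G)
    (hF : ∀ J ∈ S, ReflectInvariant J F) (hG : ∀ J ∈ S, ReflectInvariant J G)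
    (h : IsPolarPair 1 F G) : SantaloBound p V T 1 F G := by
  refine .of_indicator_closedBall hp hT fun k => ?_
  have constant_tendsto : Tendsto (fun δ : ℝ => 1 * ENNReal.ofReal (Real.exp (Fintype.card ι *
      (δ * (2 * k + δ)))) * (∫⁻ x, ENNReal.ofReal (Real.exp (-V x))) ^ p) (𝓝[>] 0)
      (𝓝 (1 * (∫⁻ x, ENNReal.ofReal (Real.exp (-V x))) ^ p)) := by
    have hcont : Continuous fun δ : ℝ => 1 * ENNReal.ofReal (Real.exp (Fintype.card ι *
        (δ * (2 * k + δ)))) := by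
      simp only [one_mul]
      exact ENNReal.continuous_ofReal.comp (by fun_prop)
    refine ENNReal.Tendsto.mul_const ?_ (Or.inl one_ne_zero)
    simpa using (hcont.tendsto 0).mono_left (nhdsWithin_le_nhds (s := Ioi 0))
  refine ge_of_tendsto constant_tendsto ?_
  filter_upwards [self_mem_nhdsWithin] with δ hδ
  have thickened := H _ _ _
    { polar := h.thicken_indicator_closedBall (le_of_lt hδ) k
      lsc_left := lowerSemicontinuous_thicken _ _
      lsc_right := lowerSemicontinuous_thicken _ _
      invariant_left := fun J hJ => ((hF J hJ).indicator_closedBall k).thicken δ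
      invariant_right := fun J hJ => ((hG J hJ).indicator_closedBall k).thicken δ }
  refine le_trans ?_ thickened
  have := sub_pos.2 hp
  gcongr <;> exact le_thicken hδ _ _

end Thicken

section ChangesOfVariables

theorem lintegral_pi_prod_eq_prod_lintegral {ι : Type*} [Fintype ι] {X : ι → Type*}
    [∀ i, MeasurableSpace (X i)] (μ : ∀ i, Measure (X i)) [∀ i, SigmaFinite (μ i)]
    {f : ∀ i, X i → ℝ≥0∞} (hf : ∀ i, Measurable (f i)) :
    ∫⁻ x, ∏ i, f i (x i) ∂Measure.pi μ = ∏ i, ∫⁻ t, f i t ∂μ i := by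
  classical
  have lmarginal_prod (s : Finset ι) :
      ∫⋯∫⁻_s, (fun x => ∏ i ∈ s, f i (x i)) ∂μ = fun _ => ∏ i ∈ s, ∫⁻ t, f i t ∂μ i := by
    induction s using Finset.induction_on with
    | empty => simp
    | insert i s hi ih =>
      have peel (x : ∀ j, X j) (t : X i) :
          ∏ j ∈ insert i s, f j (Function.update x i t j) = f i t * ∏ j ∈ s, f j (x j) := by
        rw [Finset.prod_insert hi, Function.update_self]
        refine congrArg _ (Finset.prod_congr rfl fun j hj => ?_)
        rw [Function.update_of_ne (ne_of_mem_of_not_mem hj hi)]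
      rw [lmarginal_insert' _ (by fun_prop) hi]
      simp only [peel, lintegral_mul_const _ (hf i)]
      funext x
      rw [lmarginal, lintegral_const_mul _ (by fun_prop), Finset.prod_insert hi]
      exact congrArg _ (congrFun ih x)
  rcases isEmpty_or_nonempty (∀ i, X i) with h | ⟨⟨x⟩⟩
  · obtain ⟨i, hi⟩ := isEmpty_pi.1 h
    rw [lintegral_of_isEmpty, Finset.prod_eq_zero (Finset.mem_univ i) (lintegral_of_isEmpty ..)]
  · rw [lintegral_eq_lmarginal_univ x, lmarginal_prod]

theorem pi_withDensity {ι : Type*} [Fintype ι] {X : ι → Type*} [∀ i, MeasurableSpace (X i)]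
    (μ : ∀ i, Measure (X i)) [∀ i, SigmaFinite (μ i)] {w : ∀ i, X i → ℝ≥0∞}
    (hw : ∀ i, Measurable (w i)) [∀ i, SigmaFinite ((μ i).withDensity (w i))] :
    Measure.pi (fun i => (μ i).withDensity (w i))
      = (Measure.pi μ).withDensity fun x => ∏ i, w i (x i) := by
  refine Measure.pi_eq fun s hs => ?_
  have indicator_prod (x : ∀ i, X i) : (univ.pi s).indicator (fun x => ∏ i, w i (x i)) x
      = ∏ i, (s i).indicator (w i) (x i) := by
    by_cases hx : x ∈ univ.pi s
    · rw [indicator_of_mem hx]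
      exact Finset.prod_congr rfl fun i _ => (indicator_of_mem (hx i (mem_univ i)) _).symm
    · obtain ⟨i, hi⟩ : ∃ i, x i ∉ s i := by simpa using hx
      rw [indicator_of_notMem hx,
        Finset.prod_eq_zero (Finset.mem_univ i) (indicator_of_notMem hi _)]
  rw [withDensity_apply _ (.univ_pi hs), ← lintegral_indicator (.univ_pi hs)]
  simp only [indicator_prod, withDensity_apply _ (hs _), ← lintegral_indicator (hs _)]
  exact lintegral_pi_prod_eq_prod_lintegral μ fun i => (hw i).indicator (hs i)

theorem lintegral_eq_lintegral_sphere {E : Type*} [NormedAddCommGroup E] [NormedSpace ℝ E]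
    [FiniteDimensional ℝ E] [Nontrivial E] [MeasurableSpace E] [BorelSpace E] (μ : Measure E)
    [μ.IsAddHaarMeasure] {F : E → ℝ≥0∞} (hF : Measurable F) :
    ∫⁻ y, F y ∂μ = ∫⁻ θ, ∫⁻ r in Ioi (0 : ℝ),
      ENNReal.ofReal (r ^ (Module.finrank ℝ E - 1)) * F (r • (θ : E)) ∂volume ∂μ.toSphere := by
  have polar_decomposition (y : ({0}ᶜ : Set E)) :
      ((homeomorphUnitSphereProd E y).2 : ℝ) • ((homeomorphUnitSphereProd E y).1 : E) = y := by
    have hy : ‖(y : E)‖ ≠ 0 := norm_ne_zero_iff.2 y.2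
    simp [smul_smul, hy]
  have polar := μ.measurePreserving_homeomorphUnitSphereProd.lintegral_comp_emb
    (Homeomorph.measurableEmbedding _) (fun z => F ((z.2 : ℝ) • (z.1 : E)))
  simp only [polar_decomposition] at polar
  have hF_prod : Measurable fun z : Metric.sphere (0 : E) 1 × Ioi (0 : ℝ) =>
      F ((z.2 : ℝ) • (z.1 : E)) := hF.comp (by fun_prop)
  conv_lhs => rw [← restrict_compl_singleton (μ := μ) (0 : E),
    ← lintegral_subtype_comap (measurableSet_singleton 0).compl, polar,
    lintegral_prod _ hF_prod.aemeasurable]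
  refine lintegral_congr fun θ => ?_
  have hF_ray : Measurable fun r : Ioi (0 : ℝ) => F ((r : ℝ) • (θ : E)) := hF.comp (by fun_prop)
  rw [Measure.volumeIoiPow, lintegral_withDensity_eq_lintegral_mul _ (by fun_prop) hF_ray,
    ← lintegral_subtype_comap measurableSet_Ioi]
  rfl

theorem lintegral_Ioi_comp_mul_rpow {b k : ℝ} (hb : 0 < b) (hk : 0 < k) (g : ℝ → ℝ≥0∞) :
    ∫⁻ r in Ioi (0 : ℝ), ENNReal.ofReal (b * (k * r ^ (k - 1))) * g (b * r ^ k)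
      = ∫⁻ s in Ioi (0 : ℝ), g s := by
  have image_eq : (fun r : ℝ => b * r ^ k) '' Ioi 0 = Ioi 0 := by
    refine Subset.antisymm ?_ fun s (hs : 0 < s) => ?_
    · rintro _ ⟨r, hr, rfl⟩
      exact mul_pos hb (Real.rpow_pos_of_pos hr k)
    · refine ⟨(s / b) ^ k⁻¹, Real.rpow_pos_of_pos (div_pos hs hb) _, ?_⟩
      simp only [Real.rpow_inv_rpow (div_pos hs hb).le hk.ne', mul_div_cancel₀ s hb.ne']
  have injOn : InjOn (fun r : ℝ => b * r ^ k) (Ioi 0) := fun x hx y hy hxy =>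
    (Real.rpow_left_inj (le_of_lt hx) (le_of_lt hy) hk.ne').1 (mul_left_cancel₀ hb.ne' hxy)
  have hasDerivWithinAt (r : ℝ) (hr : r ∈ Ioi (0 : ℝ)) :
      HasDerivWithinAt (fun r : ℝ => b * r ^ k) (b * (k * r ^ (k - 1))) (Ioi 0) r :=
    ((Real.hasDerivAt_rpow_const (Or.inl (ne_of_gt hr))).const_mul b).hasDerivWithinAt
  nth_rw 2 [← image_eq]
  rw [lintegral_image_eq_lintegral_abs_deriv_mul measurableSet_Ioi hasDerivWithinAt injOn]
  refine setLIntegral_congr_fun measurableSet_Ioi fun r (hr : 0 < r) => ?_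
  rw [abs_of_pos (by positivity)]

theorem lintegral_Ioi_pow_mul_comp_mul_rpow (m : ℕ) {b k : ℝ} (hb : 0 < b) (hk : 0 < k)
    (g : ℝ → ℝ≥0∞) :
    ∫⁻ r in Ioi (0 : ℝ), ENNReal.ofReal (r ^ m) * g (b * r ^ k)
      = ∫⁻ s in Ioi (0 : ℝ), ENNReal.ofReal (s ^ m) *
          (ENNReal.ofReal k⁻¹ * (ENNReal.ofReal (s ^ (k - 1) * b) ^ (-((m + 1) / k)) * g s)) := by
  conv_rhs => rw [← lintegral_Ioi_comp_mul_rpow hb hk]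
  refine setLIntegral_congr_fun measurableSet_Ioi fun r (hr : 0 < r) => ?_
  set u := b * r ^ (k - 1) with hu_def
  have hu : 0 < u := by positivity
  have stretch_eq : b * r ^ k = u * r := by
    rw [hu_def, mul_assoc, ← Real.rpow_add_one hr.ne', sub_add_cancel]
  have base_eq : (b * r ^ k) ^ (k - 1) * b = u ^ k := by
    rw [stretch_eq, Real.mul_rpow hu.le hr.le, mul_assoc, mul_comm _ b, ← hu_def,
      ← Real.rpow_add_one hu.ne', sub_add_cancel]
  have density_eq :
      r ^ m = b * (k * r ^ (k - 1)) * ((u * r) ^ m * (k⁻¹ * (u ^ (m + 1))⁻¹)) := by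
    rw [mul_left_comm b, ← hu_def, mul_pow, pow_succ]
    field_simp
  rw [base_eq, stretch_eq, ENNReal.ofReal_rpow_of_pos (by positivity), ← Real.rpow_mul hu.le,
    mul_neg, mul_div_cancel₀ _ hk.ne', Real.rpow_neg hu.le, ← Nat.cast_add_one, Real.rpow_natCast,
    density_eq, ENNReal.ofReal_mul (by positivity), ENNReal.ofReal_mul (by positivity),
    ENNReal.ofReal_mul (p := _ ^ m) (by positivity), ENNReal.ofReal_mul (p := k⁻¹) (by positivity)]
  ring

theorem map_smul_self_addHaar {E : Type*} [NormedAddCommGroup E] [NormedSpace ℝ E]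
    [FiniteDimensional ℝ E] [Nontrivial E] [MeasurableSpace E] [BorelSpace E] (μ : Measure E)
    [μ.IsAddHaarMeasure] {ψ : E → ℝ} {a : ℝ} (ha : 0 ≤ a) (hψ : Measurable ψ)
    (hψ_pos : ∀ y, y ≠ 0 → 0 < ψ y) (hψ_smul : ∀ r : ℝ, 0 < r → ∀ y, ψ (r • y) = r ^ a * ψ y) :
    μ.map (fun y => ψ y • y) = ENNReal.ofReal (1 + a)⁻¹ • μ.withDensity fun z =>
      ENNReal.ofReal (ψ z) ^ (-(Module.finrank ℝ E / (1 + a))) := by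
  refine Measure.ext_of_lintegral _ fun F hF => ?_
  obtain ⟨m, hm⟩ := Nat.exists_eq_succ_of_ne_zero (Module.finrank_pos (R := ℝ) (M := E)).ne'
  have h1 : 0 < 1 + a := by linarith
  rw [lintegral_map hF (by fun_prop), lintegral_smul_measure, smul_eq_mul,
    lintegral_withDensity_eq_lintegral_mul _ (by fun_prop) hF,
    ← lintegral_const_mul _ (by fun_prop), lintegral_eq_lintegral_sphere μ (by fun_prop),
    lintegral_eq_lintegral_sphere μ (by fun_prop)]
  refine lintegral_congr fun θ => ?_
  have hθ : 0 < ψ θ := hψ_pos _ fun h => by simpa [h] using θ.2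
  have on_ray := lintegral_Ioi_pow_mul_comp_mul_rpow m hθ h1 fun r => F (r • (θ : E))
  calc _ = ∫⁻ r in Ioi (0 : ℝ), ENNReal.ofReal (r ^ m) * F ((ψ θ * r ^ (1 + a)) • (θ : E)) := by
        refine setLIntegral_congr_fun measurableSet_Ioi fun r (hr : 0 < r) => ?_
        simp only [hψ_smul r hr, smul_smul, hm, Nat.succ_sub_one, add_comm 1 a,
          Real.rpow_add_one hr.ne']
        ring_nf
    _ = _ := by
        rw [on_ray]
        refine setLIntegral_congr_fun measurableSet_Ioi fun r (hr : 0 < r) => ?_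
        simp only [Pi.mul_apply, hψ_smul r hr, hm, Nat.succ_sub_one, add_sub_cancel_left,
          Nat.cast_succ]

/-- The odd extension `|t|^(a-1) t` of the power function `t ↦ t^a`. -/
def signedPow (a t : ℝ) : ℝ := |t| ^ (a - 1) * t

theorem abs_signedPow {a : ℝ} (ha : 0 < a) (t : ℝ) : |signedPow a t| = |t| ^ a := by
  rcases eq_or_ne t 0 with rfl | ht
  · simp [signedPow, Real.zero_rpow ha.ne']
  · rw [signedPow, abs_mul, abs_of_nonneg (by positivity), ← Real.rpow_add_one (abs_ne_zero.2 ht),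
      sub_add_cancel]

theorem signedPow_of_nonneg {a t : ℝ} (ha : 0 < a) (ht : 0 ≤ t) : signedPow a t = t ^ a := by
  have habs := abs_signedPow ha t
  have signedPow_nonneg : 0 ≤ signedPow a t := mul_nonneg (by positivity) ht
  rwa [abs_of_nonneg ht, abs_of_nonneg signedPow_nonneg] at habs

theorem signedPow_neg (a t : ℝ) : signedPow a (-t) = -signedPow a t := by
  simp [signedPow]

theorem signedPow_mul {a r : ℝ} (ha : 0 < a) (hr : 0 ≤ r) (t : ℝ) :
    signedPow a (r * t) = r ^ a * signedPow a t := by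
  rw [← signedPow_of_nonneg ha hr, signedPow, signedPow, signedPow, abs_mul,
    Real.mul_rpow (abs_nonneg _) (abs_nonneg _)]
  ring

theorem signedPow_signedPow_inv {a : ℝ} (ha : 0 < a) (t : ℝ) :
    signedPow a (signedPow a⁻¹ t) = t := by
  rcases eq_or_ne t 0 with rfl | ht
  · simp [signedPow]
  · have h0 : 0 < |t| := abs_pos.2 ht
    rw [signedPow, abs_signedPow (inv_pos.2 ha), signedPow, ← mul_assoc, ← Real.rpow_mul h0.le,
      ← Real.rpow_add h0, mul_sub, inv_mul_cancel₀ ha.ne']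
    simp

theorem hasDerivAt_signedPow (a : ℝ) {t : ℝ} (ht : t ≠ 0) :
    HasDerivAt (signedPow a) (a * |t| ^ (a - 1)) t := by
  refine (((hasDerivAt_abs ht).rpow_const (p := a - 1) (Or.inl (abs_ne_zero.2 ht))).mul
    (hasDerivAt_id t)).congr_deriv ?_
  have abs_pow_eq : |t| ^ (a - 1) = |t| ^ (a - 1 - 1) * |t| := by
    rw [← Real.rpow_add_one (abs_ne_zero.2 ht), sub_add_cancel]
  calc ((SignType.sign t : ℝ) * (a - 1) * |t| ^ (a - 1 - 1)) * t + |t| ^ (a - 1) * 1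
      = (a - 1) * (|t| ^ (a - 1 - 1) * (SignType.sign t * t)) + |t| ^ (a - 1) := by ring
    _ = a * |t| ^ (a - 1) := by rw [sign_mul_self, ← abs_pow_eq]; ring

theorem measurable_signedPow (a : ℝ) : Measurable (signedPow a) := by
  unfold signedPow
  fun_prop

/-- The density `a |s|^(a-1)` of the image of Lebesgue measure under the signed power `a⁻¹`. It is
`∞` at the origin when `a < 1`, which keeps it quasiconcave. -/
def powDensity (a s : ℝ) : ℝ≥0∞ := ENNReal.ofReal a * ENNReal.ofReal |s| ^ (a - 1)

theorem measurable_powDensity (a : ℝ) : Measurable (powDensity a) := by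
  unfold powDensity
  fun_prop

theorem map_signedPow_volume {a : ℝ} (ha : 0 < a) :
    (volume : Measure ℝ).map (signedPow a) = volume.withDensity (powDensity a⁻¹) := by
  have ha' : 0 < a⁻¹ := inv_pos.2 ha
  have leftInverse : Function.LeftInverse (signedPow a) (signedPow a⁻¹) :=
    signedPow_signedPow_inv ha
  have rightInverse : Function.RightInverse (signedPow a) (signedPow a⁻¹) := fun t => by
    simpa using signedPow_signedPow_inv ha' t
  have signedPow_zero : signedPow a⁻¹ 0 = 0 := by simp [signedPow]
  have image_eq : signedPow a⁻¹ '' {0}ᶜ = {0}ᶜ := by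
    rw [image_compl_eq ⟨leftInverse.injective, rightInverse.surjective⟩, image_singleton,
      signedPow_zero]
  have inverse_map := map_withDensity_abs_det_fderiv_eq_addHaar volume
    (measurableSet_singleton (0 : ℝ)).compl.nullMeasurableSet
    (fun t ht => (hasDerivAt_signedPow a⁻¹ ht).hasDerivWithinAt.hasFDerivWithinAt)
    leftInverse.injective.injOn
  rw [image_eq, restrict_compl_singleton] at inverse_map
  have density_ae_eq : (fun t => ENNReal.ofReal |(ContinuousLinearMap.toSpanSingleton ℝ
      (a⁻¹ * |t| ^ (a⁻¹ - 1))).det|) =ᵐ[volume] powDensity a⁻¹ := by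
    filter_upwards [compl_mem_ae_iff.2 (measure_singleton (0 : ℝ))] with t ht
    have h0 : 0 < |t| := abs_pos.2 ht
    rw [ContinuousLinearMap.det_toSpanSingleton, abs_of_pos (by positivity), powDensity,
      ENNReal.ofReal_mul ha'.le, ENNReal.ofReal_rpow_of_pos h0]
  rw [withDensity_congr_ae density_ae_eq] at inverse_map
  conv_lhs => rw [← inverse_map, Measure.map_map (measurable_signedPow a)
    (measurable_signedPow a⁻¹), leftInverse.comp_eq_id, Measure.map_id]

theorem map_signedPow_pi_volume {ι : Type*} [Fintype ι] {a : ℝ} (ha : 0 < a) :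
    (volume : Measure (ι → ℝ)).map (fun x i => signedPow a (x i))
      = volume.withDensity fun s => ∏ i, powDensity a⁻¹ (s i) := by
  have sigmaFinite_withDensity : SigmaFinite (volume.withDensity (powDensity a⁻¹)) := by
    refine .withDensity_of_ne_top ?_
    filter_upwards [compl_mem_ae_iff.2 (measure_singleton (0 : ℝ))] with s hs
    refine ENNReal.mul_ne_top ENNReal.ofReal_ne_top ?_
    rw [ENNReal.ofReal_rpow_of_pos (abs_pos.2 hs)]
    exact ENNReal.ofReal_ne_top
  have sigmaFinite_map : SigmaFinite ((volume : Measure ℝ).map (signedPow a)) := by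
    rwa [map_signedPow_volume ha]
  rw [volume_pi, Measure.pi_map_pi fun _ => (measurable_signedPow a).aemeasurable]
  simp only [map_signedPow_volume ha]
  exact pi_withDensity _ fun _ => measurable_powDensity a⁻¹

end ChangesOfVariables

section PowerPotential

variable {ι : Type*}

theorem convexOn_abs_apply (i : ι) : ConvexOn ℝ univ fun x : ι → ℝ => |x i| :=
  convexOn_univ_norm.comp_linearMap (LinearMap.proj i : (ι → ℝ) →ₗ[ℝ] ℝ)

theorem antitone_ennreal_rpow_of_nonpos {b : ℝ} (hb : b ≤ 0) :
    Antitone fun t : ℝ≥0∞ => t ^ b := by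
  intro s t hst
  simpa [ENNReal.rpow_neg] using
    ENNReal.inv_le_inv.2 (ENNReal.rpow_le_rpow hst (neg_nonneg.2 hb))

theorem quasiconcaveOn_powDensity_apply {a : ℝ} (ha : a ≤ 1) (i : ι) :
    QuasiconcaveOn ℝ univ fun s : ι → ℝ => powDensity a (s i) := by
  refine QuasiconvexOn.antitone_comp
    (g := fun t => ENNReal.ofReal a * ENNReal.ofReal t ^ (a - 1)) (fun s t hst => ?_)
    (convexOn_abs_apply i).quasiconvexOn
  exact mul_le_mul_right (antitone_ennreal_rpow_of_nonpos (sub_nonpos.2 ha)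
    (ENNReal.ofReal_le_ofReal hst)) _

variable [Fintype ι]

theorem reflectInvariant_powDensity_apply [DecidableEq ι] (a : ℝ) (J : Finset ι) (i : ι) :
    ReflectInvariant J fun s : ι → ℝ => powDensity a (s i) := fun x => by
  simp only [powDensity, abs_reflect_apply]

theorem sum_rpow_mul_rpow_one_sub_le {κ : Type*} (s : Finset κ) {θ : ℝ} (hθ : 0 < θ) (hθ1 : θ ≤ 1)
    {f g : κ → ℝ} (hf : ∀ i ∈ s, 0 ≤ f i) (hg : ∀ i ∈ s, 0 ≤ g i) :
    ∑ i ∈ s, f i ^ θ * g i ^ (1 - θ) ≤ (∑ i ∈ s, f i) ^ θ * (∑ i ∈ s, g i) ^ (1 - θ) := by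
  rcases hθ1.eq_or_lt with rfl | hθ1
  · simp
  · have holder := Real.inner_le_Lp_mul_Lq_of_nonneg s (.inv_one_sub_inv hθ hθ1)
      (fun i hi => Real.rpow_nonneg (hf i hi) θ) (fun i hi => Real.rpow_nonneg (hg i hi) (1 - θ))
    rwa [Finset.sum_congr rfl fun i hi => Real.rpow_rpow_inv (hf i hi) hθ.ne',
      Finset.sum_congr rfl fun i hi => Real.rpow_rpow_inv (hg i hi) (sub_pos.2 hθ1).ne',
      one_div, one_div, inv_inv, inv_inv] at holder

/-- The sum `|x|_r^r` of the `r`-th powers of the coordinates of `x`. -/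
def absPowSum (r : ℝ) (x : ι → ℝ) : ℝ := ∑ i, |x i| ^ r

theorem absPowSum_nonneg (r : ℝ) (x : ι → ℝ) : 0 ≤ absPowSum r x :=
  Finset.sum_nonneg fun _ _ => by positivity

theorem absPowSum_pos (r : ℝ) {x : ι → ℝ} (hx : x ≠ 0) : 0 < absPowSum r x := by
  obtain ⟨i, hi⟩ := Function.ne_iff.1 hx
  exact Finset.sum_pos' (fun _ _ => by positivity)
    ⟨i, Finset.mem_univ i, Real.rpow_pos_of_pos (abs_pos.2 hi) r⟩

theorem measurable_absPowSum (r : ℝ) : Measurable (absPowSum r : (ι → ℝ) → ℝ) := by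
  unfold absPowSum
  fun_prop

theorem absPowSum_smul (r : ℝ) {a : ℝ} (ha : 0 ≤ a) (x : ι → ℝ) :
    absPowSum r (a • x) = a ^ r * absPowSum r x := by
  simp only [absPowSum, Pi.smul_apply, smul_eq_mul, abs_mul, abs_of_nonneg ha,
    Real.mul_rpow ha (abs_nonneg _), Finset.mul_sum]

theorem absPowSum_reflect [DecidableEq ι] (r : ℝ) (J : Finset ι) (x : ι → ℝ) :
    absPowSum r (reflect J x) = absPowSum r x := by
  simp only [absPowSum, abs_reflect_apply]

theorem absPowSum_signedPow {a : ℝ} (ha : 0 < a) (r : ℝ) (x : ι → ℝ) :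
    absPowSum (r / a) (fun i => signedPow a (x i)) = absPowSum r x := by
  simp only [absPowSum, abs_signedPow ha, ← Real.rpow_mul (abs_nonneg _), mul_div_cancel₀ r ha.ne']

theorem convexOn_absPowSum {r : ℝ} (hr : 1 ≤ r) :
    ConvexOn ℝ univ (absPowSum r : (ι → ℝ) → ℝ) := by
  have convexOn_term (i : ι) : ConvexOn ℝ univ fun x : ι → ℝ => |x i| ^ r := by
    refine ⟨convex_univ, fun x hx y hy a b ha hb hab => ?_⟩
    exact (Real.rpow_le_rpow (abs_nonneg _) ((convexOn_abs_apply i).2 hx hy ha hb hab)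
      (zero_le_one.trans hr)).trans
      ((convexOn_rpow hr).2 (abs_nonneg (x i)) (abs_nonneg (y i)) ha hb hab)
  have := Finset.sum_induction (s := Finset.univ) (fun i (x : ι → ℝ) => |x i| ^ r) (ConvexOn ℝ univ)
    (fun _ _ => .add) (convexOn_const 0 convex_univ) fun i _ => convexOn_term i
  rwa [Finset.sum_fn] at this

/-- The potential `c |x|_q^p`, written through `|x|_q^q`. -/
def potential (p q c : ℝ) (x : ι → ℝ) : ℝ := c * absPowSum q x ^ (p / q)

/-- The gradient of `potential p q c`. -/
def potentialGrad (p q c : ℝ) (y : ι → ℝ) (i : ι) : ℝ :=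
  c * p * absPowSum q y ^ (p / q - 1) * signedPow (q - 1) (y i)

theorem measurable_potential (p q c : ℝ) : Measurable (potential p q c : (ι → ℝ) → ℝ) :=
  ((measurable_absPowSum q).pow_const _).const_mul c

theorem measurable_potentialGrad (p q c : ℝ) :
    Measurable (potentialGrad p q c : (ι → ℝ) → ι → ℝ) :=
  measurable_pi_lambda _ fun i => (((measurable_absPowSum q).pow_const _).const_mul _).mul
    ((measurable_signedPow _).comp (measurable_pi_apply i))

theorem potentialGrad_reflect [DecidableEq ι] (p q c : ℝ) (J : Finset ι) (y : ι → ℝ) :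
    potentialGrad p q c (reflect J y) = reflect J (potentialGrad p q c y) := by
  funext i
  by_cases hi : i ∈ J <;> simp [potentialGrad, absPowSum_reflect, hi, signedPow_neg]

variable {p q c : ℝ}

theorem absPowSum_geom_mean_le (hq : 1 < q) (hqp : q ≤ p) {x y : ι → ℝ} (hx : 0 ≤ x)
    (hy : 0 ≤ y) :
    absPowSum q (fun i => x i ^ (1 / p) * y i ^ ((p - 1) / p))
      ≤ (∑ i, x i * signedPow (q - 1) (y i)) ^ (q / p) * absPowSum q y ^ (1 - q / p) := by
  have hp : 0 < p := by linarith
  have hq1 : 0 < q - 1 := sub_pos.2 hq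
  have term_eq (i : ι) : |x i ^ (1 / p) * y i ^ ((p - 1) / p)| ^ q
      = (x i * y i ^ (q - 1)) ^ (q / p) * (y i ^ q) ^ (1 - q / p) := by
    have hxi : 0 ≤ x i := hx i
    have hyi : 0 ≤ y i := hy i
    have := sub_nonneg.2 ((div_le_one hp).2 hqp)
    have exponent_eq : (p - 1) / p * q = (q - 1) * (q / p) + q * (1 - q / p) := by
      field_simp
      ring
    rw [abs_of_nonneg (by positivity), Real.mul_rpow (by positivity) (by positivity),
      Real.mul_rpow hxi (by positivity), ← Real.rpow_mul hxi, ← Real.rpow_mul hyi,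
      ← Real.rpow_mul hyi, ← Real.rpow_mul hyi, exponent_eq,
      Real.rpow_add_of_nonneg hyi (by positivity) (by positivity)]
    ring_nf
  simp only [absPowSum, term_eq, abs_of_nonneg (hy _), signedPow_of_nonneg hq1 (hy _)]
  refine sum_rpow_mul_rpow_one_sub_le _ (by positivity) (div_le_one_of_le₀ hqp hp.le)
    (fun i _ => mul_nonneg (hx i) (Real.rpow_nonneg (hy i) _))
    fun i _ => Real.rpow_nonneg (hy i) _

theorem potential_geom_mean_le (hq : 1 < q) (hqp : q ≤ p) (hc : 0 ≤ c) {x y : ι → ℝ}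
    (hx : 0 ≤ x) (hy : 0 ≤ y) :
    potential p q c (fun i => x i ^ (1 / p) * y i ^ ((p - 1) / p))
      ≤ 1 / p * (x ⬝ᵥ potentialGrad p q c y) := by
  have hp : 0 < p := by linarith
  have hq0 : 0 < q := by linarith
  set D := ∑ i, x i * signedPow (q - 1) (y i) with hD
  have hY : 0 ≤ absPowSum q y := absPowSum_nonneg q y
  have hD0 : 0 ≤ D := Finset.sum_nonneg fun i _ => mul_nonneg (hx i)
    (mul_nonneg (Real.rpow_nonneg (abs_nonneg _) _) (hy i))
  have dotProduct_eq :
      x ⬝ᵥ potentialGrad p q c y = p * (c * (D * absPowSum q y ^ (p / q - 1))) := by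
    simp only [dotProduct, potentialGrad, hD, Finset.sum_mul, Finset.mul_sum]
    exact Finset.sum_congr rfl fun i _ => by ring
  rw [dotProduct_eq, ← mul_assoc, one_div_mul_cancel hp.ne', one_mul]
  refine mul_le_mul_of_nonneg_left ?_ hc
  calc absPowSum q (fun i => x i ^ (1 / p) * y i ^ ((p - 1) / p)) ^ (p / q)
      ≤ (D ^ (q / p) * absPowSum q y ^ (1 - q / p)) ^ (p / q) :=
        Real.rpow_le_rpow (absPowSum_nonneg _ _) (absPowSum_geom_mean_le hq hqp hx hy)
          (by positivity)
    _ = D * absPowSum q y ^ (p / q - 1) := by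
        rw [Real.mul_rpow (by positivity) (by positivity), ← Real.rpow_mul hD0,
          ← Real.rpow_mul hY, div_mul_div_cancel₀ hp.ne', div_self hq0.ne', Real.rpow_one]
        congr 2
        field_simp

theorem isSantaloPotential_potential [DecidableEq ι] (hq : 1 < q) (hqp : q ≤ p) (hc : 0 ≤ c) :
    IsSantaloPotential p (potential p q c : (ι → ℝ) → ℝ) (potentialGrad p q c) where
  measurable_potential := measurable_potential p q c
  measurable_gradient := measurable_potentialGrad p q c
  potential_reflect J x := by simp only [potential, absPowSum_reflect]
  gradient_reflect := potentialGrad_reflect p q c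
  potential_geom_mean_le x y := potential_geom_mean_le hq hqp hc (abs_nonneg x) (abs_nonneg y)

/-- The factor by which `y` is stretched, as a function of `t = |y|_q^q`, before the signed power
`q - 1` is applied coordinatewise to give `potentialGrad p q c y`. -/
def stretchFactor (p q c t : ℝ) : ℝ := (c * p * t ^ (p / q - 1)) ^ (q - 1)⁻¹

theorem measurable_stretchFactor (p q c : ℝ) : Measurable (stretchFactor p q c) := by
  unfold stretchFactor
  fun_prop

theorem stretchFactor_pos (hp : 0 < p) (hc : 0 < c) {t : ℝ} (ht : 0 < t) :
    0 < stretchFactor p q c t := by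
  unfold stretchFactor
  positivity

theorem monotoneOn_stretchFactor (hq : 1 < q) (hqp : q ≤ p) (hc : 0 ≤ c) :
    MonotoneOn (stretchFactor p q c) (Ici 0) := by
  intro s hs t _ hst
  have := sub_pos.2 hq
  have hp : 0 < p := by linarith
  have exponent_nonneg : 0 ≤ p / q - 1 := sub_nonneg.2 ((one_le_div (by linarith)).2 hqp)
  have hs0 : 0 ≤ s := hs
  unfold stretchFactor
  gcongr

theorem potentialGrad_eq_signedPow_stretch (hq : 1 < q) (hp : 0 < p) (hc : 0 ≤ c) (y : ι → ℝ) :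
    potentialGrad p q c y =
      fun i => signedPow (q - 1) ((stretchFactor p q c (absPowSum q y) • y) i) := by
  have hq1 : 0 < q - 1 := sub_pos.2 hq
  have hY := absPowSum_nonneg q y
  funext i
  rw [Pi.smul_apply, smul_eq_mul, signedPow_mul hq1 (by unfold stretchFactor; positivity),
    stretchFactor, Real.rpow_inv_rpow (by positivity) hq1.ne', potentialGrad]

theorem stretchFactor_absPowSum_smul (hq : 1 < q) (hp : 0 < p) (hc : 0 ≤ c) {r : ℝ} (hr : 0 < r)
    (y : ι → ℝ) :
    stretchFactor p q c (absPowSum q (r • y))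
      = r ^ ((p - q) / (q - 1)) * stretchFactor p q c (absPowSum q y) := by
  have hq0 : q ≠ 0 := by linarith
  have hY := absPowSum_nonneg q y
  have exponent_eq : q * (p / q - 1) = p - q := by field_simp
  rw [stretchFactor, absPowSum_smul q hr.le,
    Real.mul_rpow (by positivity) hY, ← Real.rpow_mul hr.le, exponent_eq, mul_left_comm,
    Real.mul_rpow (by positivity) (by positivity), ← Real.rpow_mul hr.le, ← div_eq_mul_inv,
    stretchFactor]

/-- The power of the stretch factor that appears in the density of the image of Lebesgue measure
under `potentialGrad p q c`, where `N` is the dimension; after the signed power `q - 1` the sum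
`|y|_q^q` has become a sum of powers with the conjugate exponent. -/
def stretchDensity (p q c N : ℝ) (s : ι → ℝ) : ℝ≥0∞ :=
  ENNReal.ofReal (stretchFactor p q c (absPowSum (q / (q - 1)) s)) ^
    (-(N / (1 + (p - q) / (q - 1))))

theorem measurable_stretchDensity (p q c N : ℝ) :
    Measurable (stretchDensity p q c N : (ι → ℝ) → ℝ≥0∞) :=
  (((measurable_stretchFactor p q c).comp (measurable_absPowSum _)).ennreal_ofReal).pow_const _

theorem map_withDensity_comp {X Y : Type*} [MeasurableSpace X] [MeasurableSpace Y] (μ : Measure X)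
    {f : X → Y} {w : Y → ℝ≥0∞} (hf : Measurable f) (hw : Measurable w) :
    (μ.withDensity (w ∘ f)).map f = (μ.map f).withDensity w := by
  ext s hs
  rw [Measure.map_apply hf hs, withDensity_apply _ (hf hs), withDensity_apply _ hs,
    setLIntegral_map hs hw hf]
  rfl

theorem map_potentialGrad_volume [Nonempty ι] (hq : 1 < q) (hqp : q ≤ p) (hc : 0 < c) :
    (volume : Measure (ι → ℝ)).map (potentialGrad p q c)
      = ENNReal.ofReal (1 + (p - q) / (q - 1))⁻¹ •
        (volume.withDensity fun s => ∏ i, powDensity (q - 1)⁻¹ (s i)).withDensity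
          (stretchDensity p q c (Fintype.card ι)) := by
  have hq1 : 0 < q - 1 := sub_pos.2 hq
  have hp : 0 < p := by linarith
  set N : (ι → ℝ) → ι → ℝ := fun x i => signedPow (q - 1) (x i) with hN_def
  have hN : Measurable N :=
    measurable_pi_lambda _ fun i => (measurable_signedPow _).comp (measurable_pi_apply i)
  have hψ : Measurable fun y : ι → ℝ => stretchFactor p q c (absPowSum q y) :=
    (measurable_stretchFactor p q c).comp (measurable_absPowSum q)
  have factorization : potentialGrad p q c =
      N ∘ fun y : ι → ℝ => stretchFactor p q c (absPowSum q y) • y :=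
    funext fun y => potentialGrad_eq_signedPow_stretch hq hp hc.le y
  have density_eq : (fun z : ι → ℝ => ENNReal.ofReal (stretchFactor p q c (absPowSum q z)) ^
      (-(Module.finrank ℝ (ι → ℝ) / (1 + (p - q) / (q - 1)))))
        = stretchDensity p q c (Fintype.card ι) ∘ N := by
    funext z
    rw [Function.comp_apply, stretchDensity, hN_def, absPowSum_signedPow hq1,
      Module.finrank_fintype_fun_eq_card]
  rw [factorization, ← Measure.map_map hN (by fun_prop),
    map_smul_self_addHaar volume (div_nonneg (sub_nonneg.2 hqp) hq1.le) hψ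
      (fun y hy => stretchFactor_pos hp hc (absPowSum_pos q hy))
      (fun r hr y => stretchFactor_absPowSum_smul hq hp hc.le hr y),
    Measure.map_smul, density_eq, map_withDensity_comp _ hN (measurable_stretchDensity _ _ _ _),
    map_signedPow_pi_volume hq1]

theorem reflectInvariant_stretchDensity [DecidableEq ι] (p q c N : ℝ) (J : Finset ι) :
    ReflectInvariant J (stretchDensity p q c N) := fun x => by
  simp only [stretchDensity, absPowSum_reflect]

theorem quasiconcaveOn_stretchDensity {N : ℝ} (hq : 1 < q) (hqp : q ≤ p) (hc : 0 ≤ c)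
    (hN : 0 ≤ N) : QuasiconcaveOn ℝ univ (stretchDensity p q c N : (ι → ℝ) → ℝ≥0∞) := by
  have hq1 : 0 < q - 1 := sub_pos.2 hq
  have := sub_nonneg.2 hqp
  have conjugate_ge_one : 1 ≤ q / (q - 1) := (one_le_div hq1).2 (by linarith)
  have quasiconvex_sum := (convexOn_absPowSum (ι := ι) conjugate_ge_one).quasiconvexOn
  have quasiconvex_stretch : QuasiconvexOn ℝ univ fun s : ι → ℝ =>
      stretchFactor p q c (absPowSum (q / (q - 1)) s) := by
    rw [quasiconvexOn_iff_le_max] at quasiconvex_sum ⊢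
    refine ⟨convex_univ, fun x hx y hy a b ha hb hab => ?_⟩
    have monotoneOn := monotoneOn_stretchFactor hq hqp hc
    rw [← monotoneOn.map_max (absPowSum_nonneg _ x) (absPowSum_nonneg _ y)]
    exact monotoneOn (absPowSum_nonneg _ _) ((absPowSum_nonneg _ x).trans (le_max_left _ _))
      (quasiconvex_sum.2 hx hy ha hb hab)
  refine QuasiconvexOn.antitone_comp
    (g := fun t => ENNReal.ofReal t ^ (-(N / (1 + (p - q) / (q - 1))))) (fun s t hst => ?_)
    quasiconvex_stretch
  exact antitone_ennreal_rpow_of_nonpos (neg_nonpos.2 (by positivity))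
    (ENNReal.ofReal_le_ofReal hst)

theorem symmMonotone_map_potentialGrad [DecidableEq ι] (hq : 2 ≤ q) (hqp : q ≤ p) (hc : 0 ≤ c)
    (I : Finset ι) : SymmMonotone I ((volume : Measure (ι → ℝ)).map (potentialGrad p q c)) := by
  by_cases degenerate : c = 0 ∨ IsEmpty ι
  · have grad_eq_zero : (potentialGrad p q c : (ι → ℝ) → ι → ℝ) = fun _ => 0 := by
      funext y i
      obtain rfl | h := degenerate
      · simp [potentialGrad]
      · exact h.elim i
    rw [grad_eq_zero, Measure.map_const]
    exact (symmMonotone_dirac_zero I).smul _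
  · rw [not_or, not_isEmpty_iff] at degenerate
    obtain ⟨hc0, _⟩ := degenerate
    have hq1 : 1 < q := by linarith
    have exponent_le_one : (q - 1)⁻¹ ≤ 1 := inv_le_one_of_one_le₀ (by linarith)
    have product_eq : (fun s : ι → ℝ => ∏ i, powDensity (q - 1)⁻¹ (s i)) =
        ∏ i, fun s : ι → ℝ => powDensity (q - 1)⁻¹ (s i) := by
      simp only [Finset.prod_fn]
    rw [map_potentialGrad_volume hq1 hqp (hc.lt_of_ne' hc0), product_eq]
    refine SymmMonotone.smul ?_ _
    refine ((symmMonotone_volume I).withDensity_prod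
      (fun i _ => (measurable_powDensity _).comp (measurable_pi_apply i))
      (fun i _ => reflectInvariant_powDensity_apply _ I i)
      fun i _ => quasiconcaveOn_powDensity_apply exponent_le_one i).withDensity
      (measurable_stretchDensity _ _ _ _) (reflectInvariant_stretchDensity _ _ _ _ I)
      (quasiconcaveOn_stretchDensity hq1 hqp hc (Nat.cast_nonneg _))

end PowerPotential

section EuclideanSpace

variable {n : ℕ}

theorem mul_lqNorm_rpow_eq_potential (p q c : ℝ) (x : EuclideanSpace ℝ (Fin n)) :
    c * lqNorm q x ^ p = potential p q c x.ofLp := by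
  rw [lqNorm, ← absPowSum, ← Real.rpow_mul (absPowSum_nonneg _ _), one_div_mul_eq_div, potential]

theorem hasGradientAt_potential {p q : ℝ} (hq : 1 < q) (c : ℝ) {y : EuclideanSpace ℝ (Fin n)}
    (hy : y ≠ 0) :
    HasGradientAt (fun x : EuclideanSpace ℝ (Fin n) => potential p q c x.ofLp)
      (WithLp.toLp 2 (potentialGrad p q c y.ofLp)) y := by
  have hasFDerivAt_apply (i : Fin n) : HasFDerivAt (fun x : EuclideanSpace ℝ (Fin n) => x i)
      (EuclideanSpace.proj i : EuclideanSpace ℝ (Fin n) →L[ℝ] ℝ) y :=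
    (EuclideanSpace.proj i : EuclideanSpace ℝ (Fin n) →L[ℝ] ℝ).hasFDerivAt
  have hasFDerivAt_sum : HasFDerivAt (fun x : EuclideanSpace ℝ (Fin n) => absPowSum q x.ofLp)
      (∑ i, (q * |y i| ^ (q - 2) * y i) •
        (EuclideanSpace.proj i : EuclideanSpace ℝ (Fin n) →L[ℝ] ℝ)) y := by
    refine HasFDerivAt.fun_sum fun i _ => ?_
    exact (hasDerivAt_abs_rpow (y i) hq).comp_hasFDerivAt y (hasFDerivAt_apply i)
  have sum_pos : 0 < absPowSum q y.ofLp := absPowSum_pos q (mt (WithLp.ofLp_eq_zero 2).1 hy)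
  rw [hasGradientAt_iff_hasFDerivAt]
  refine ((hasFDerivAt_sum.rpow_const (p := p / q) (Or.inl sum_pos.ne')).const_mul c).congr_fderiv
    ?_
  ext v
  simp only [InnerProductSpace.toDual_apply_apply, PiLp.inner_apply, RCLike.inner_apply,
    conj_trivial, potentialGrad, signedPow, smul_apply, sum_apply, smul_eq_mul, Finset.mul_sum,
    PiLp.proj_apply]
  refine Finset.sum_congr rfl fun i _ => ?_
  have hq0 : q ≠ 0 := by linarith
  rw [sub_sub, one_add_one_eq_two]
  field_simp

theorem isPolarPair_exp_neg_legendre (Φ : EuclideanSpace ℝ (Fin n) → EReal) :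
    IsPolarPair 1 (fun x => EReal.exp (-Φ (WithLp.toLp 2 x)))
      (fun u => EReal.exp (-legendre Φ (WithLp.toLp 2 u))) := by
  intro x u
  have young : ((x ⬝ᵥ u : ℝ) : EReal) - Φ (WithLp.toLp 2 x) ≤ legendre Φ (WithLp.toLp 2 u) := by
    refine le_iSup_of_le (WithLp.toLp 2 x) (le_of_eq ?_)
    rw [EuclideanSpace.inner_toLp_toLp, star_trivial, dotProduct_comm]
  beta_reduce
  generalize Φ (WithLp.toLp 2 x) = a at young ⊢
  refine (mul_le_mul_right (EReal.exp_monotone (EReal.neg_le_neg_iff.2 young)) _).trans ?_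
  induction a with
  | bot => simp
  | top => simp
  | coe a =>
    rw [← EReal.coe_sub, ← EReal.coe_neg, ← EReal.coe_neg, ← EReal.exp_add, ← EReal.coe_add,
      EReal.exp_coe, one_mul, neg_sub, neg_add_eq_sub, sub_sub_cancel_left]

theorem ReflectInvariant.legendre {Φ : EuclideanSpace ℝ (Fin n) → EReal} {J : Finset (Fin n)}
    (hΦ : ReflectInvariant J fun x => Φ (WithLp.toLp 2 x)) :
    ReflectInvariant J fun u => legendre Φ (WithLp.toLp 2 u) := by
  intro u
  have surjective : Function.Surjective fun x : EuclideanSpace ℝ (Fin n) =>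
      (WithLp.toLp 2 (reflect J x.ofLp) : EuclideanSpace ℝ (Fin n)) :=
    fun x => ⟨WithLp.toLp 2 (reflect J x.ofLp), by simp only [reflect_reflect_self]⟩
  refine (surjective.iSup_congr _ fun x => ?_).symm
  have invariant : Φ (WithLp.toLp 2 (reflect J x.ofLp)) = Φ x := hΦ x.ofLp
  rw [invariant, EuclideanSpace.inner_eq_star_dotProduct, EuclideanSpace.inner_eq_star_dotProduct]
  simp only [star_trivial, dotProduct_reflect]

theorem lintegral_euclideanSpace (f : EuclideanSpace ℝ (Fin n) → ℝ≥0∞) :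
    ∫⁻ x, f x = ∫⁻ x : Fin n → ℝ, f (WithLp.toLp 2 x) :=
  ((PiLp.volume_preserving_toLp (Fin n)).lintegral_comp_emb
    (MeasurableEquiv.toLp 2 (Fin n → ℝ)).measurableEmbedding f).symm

theorem gradient_potential_ae_eq {p q : ℝ} (hq : 1 < q) (c : ℝ) :
    ∀ᵐ y : Fin n → ℝ, gradient (fun x : EuclideanSpace ℝ (Fin n) => potential p q c x.ofLp)
      (WithLp.toLp 2 y) = WithLp.toLp 2 (potentialGrad p q c y) := by
  rcases isEmpty_or_nonempty (Fin n) with _ | _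
  · exact Eventually.of_forall fun _ => Subsingleton.elim _ _
  · filter_upwards [compl_mem_ae_iff.2 (measure_singleton (0 : Fin n → ℝ))] with y hy
    exact (hasGradientAt_potential hq c (mt (WithLp.toLp_eq_zero 2).1 hy)).gradient

theorem generalizedBS_of_santaloBound {p : ℝ} {V : (Fin n → ℝ) → ℝ}
    {T : (Fin n → ℝ) → Fin n → ℝ} {Φ : EuclideanSpace ℝ (Fin n) → EReal}
    (hT : ∀ᵐ y : Fin n → ℝ, gradient (fun x : EuclideanSpace ℝ (Fin n) => V x.ofLp)
      (WithLp.toLp 2 y) = WithLp.toLp 2 (T y))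
    (h : SantaloBound p V T 1 (fun x => EReal.exp (-Φ (WithLp.toLp 2 x)))
      fun u => EReal.exp (-legendre Φ (WithLp.toLp 2 u))) :
    GeneralizedBS p (fun x => V x.ofLp) Φ := by
  have integrand_ae_eq : (fun y : Fin n → ℝ => EReal.exp (-(((1 / (p - 1) : ℝ) : EReal) *
      legendre Φ (gradient (fun x : EuclideanSpace ℝ (Fin n) => V x.ofLp) (WithLp.toLp 2 y)))))
        =ᵐ[volume] fun y => EReal.exp (-legendre Φ (WithLp.toLp 2 (T y))) ^ (1 / (p - 1)) := by
    filter_upwards [hT] with y hy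
    rw [hy, ← EReal.exp_mul, mul_comm, EReal.neg_mul]
  rw [GeneralizedBS, lintegral_euclideanSpace, lintegral_euclideanSpace, lintegral_euclideanSpace,
    lintegral_congr_ae integrand_ae_eq]
  simpa only [SantaloBound, one_mul] using h

theorem generalizedBS_of_forall_isSymmetricPolarPair {p q c : ℝ} (hq : 1 < q) (hqp : q ≤ p)
    {S : Set (Finset (Fin n))}
    (H : ∀ C F G, IsSymmetricPolarPair S C F G →
      SantaloBound p (potential p q c) (potentialGrad p q c) C F G)
    {Φ : EuclideanSpace ℝ (Fin n) → EReal}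
    (hΦ : ∀ J ∈ S, ReflectInvariant J fun x => Φ (WithLp.toLp 2 x)) :
    GeneralizedBS p (fun x => c * lqNorm q x ^ p) Φ := by
  simp only [mul_lqNorm_rpow_eq_potential]
  refine generalizedBS_of_santaloBound (gradient_potential_ae_eq hq c) <|
    SantaloBound.of_forall_isSymmetricPolarPair (hq.trans_le hqp) (measurable_potentialGrad p q c) H
      (fun J hJ x => ?_) (fun J hJ u => ?_) (isPolarPair_exp_neg_legendre Φ)
  · exact congrArg (fun a => EReal.exp (-a)) (hΦ J hJ x)
  · exact congrArg (fun a => EReal.exp (-a)) ((hΦ J hJ).legendre u)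

theorem IsUnconditional.reflectInvariant {Φ : EuclideanSpace ℝ (Fin n) → EReal}
    (hΦ : IsUnconditional Φ) (J : Finset (Fin n)) :
    ReflectInvariant J fun x => Φ (WithLp.toLp 2 x) := by
  intro x
  convert hΦ (fun i => if i ∈ J then -1 else 1) (fun i => (ite_eq_or_eq _ _ _).symm)
    (WithLp.toLp 2 x) using 3 with i
  rw [reflect_apply, ite_mul, neg_one_mul, one_mul]

end EuclideanSpace

end BlaschkeSantalo

end

theorem mainTheorem2 (n : ℕ) (p q c : ℝ) (hc : 0 ≤ c) :
    ((1 < q ∧ q ≤ p) →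
      ∀ Φ : EuclideanSpace ℝ (Fin n) → EReal,
        BlaschkeSantalo.IsProper Φ → BlaschkeSantalo.IsUnconditional Φ →
          BlaschkeSantalo.GeneralizedBS p
            (fun x => c * BlaschkeSantalo.lqNorm q x ^ p) Φ) ∧
    ((2 ≤ q ∧ q ≤ p) →
      ∀ Φ : EuclideanSpace ℝ (Fin n) → EReal,
        BlaschkeSantalo.IsProper Φ → (∀ x, Φ (-x) = Φ x) →
          BlaschkeSantalo.GeneralizedBS p
            (fun x => c * BlaschkeSantalo.lqNorm q x ^ p) Φ) := by
  refine ⟨fun ⟨hq, hqp⟩ Φ _ hΦ => ?unconditional, fun ⟨hq, hqp⟩ Φ _ hΦ => ?even⟩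
  case unconditional =>
    have hV := BlaschkeSantalo.isSantaloPotential_potential (ι := Fin n) hq hqp hc
    exact BlaschkeSantalo.generalizedBS_of_forall_isSymmetricPolarPair hq hqp (S := Set.univ)
      (fun _ _ _ h => hV.santaloBound_of_invariant (hq.trans_le hqp) h)
      fun J _ => hΦ.reflectInvariant J
  case even =>
    have hq' : 1 < q := one_lt_two.trans_le hq
    have hV := BlaschkeSantalo.isSantaloPotential_potential (ι := Fin n) hq' hqp hc
    have hT := BlaschkeSantalo.symmMonotone_map_potentialGrad (ι := Fin n) hq hqp hc
    refine BlaschkeSantalo.generalizedBS_of_forall_isSymmetricPolarPair hq' hqp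
      (S := {Finset.univ})
      (fun _ _ _ h => hV.santaloBound_of_even (hq'.trans_le hqp) hT h) ?_
    rintro _ rfl
    exact BlaschkeSantalo.reflectInvariant_univ_iff.2 fun x => hΦ (WithLp.toLp 2 x)
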